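/- Let $p$ be a prime. For an ideal $J$ of a commutative ring $R$ of characteristic $p$ and $e\ge 0$ let $J^{[p^e]}$ be the ideal generated by all $u^{p^e}$, $u\in J$; for an ideal $\mathfrak b$ let $\mathfrak b^{[1/p^e]}$ be the smallest ideal $J$ with $\mathfrak b\subseteq J^{[p^e]}$. (In every ring considered below this smallest ideal exists.) For an ideal $\mathfrak a$ and a real number $\lambda>0$ let the test ideal $\tau(\mathfrak a^\lambda)$ be the stable value of the ascending chain $\left(\mathfrak a^{\lceil \lambda p^e\rceil}\right)^{[1/p^e]}$ for $e\gg 0$. For an ideal $\mathfrak a$ of a domain $R$ with $(0)\ne\mathfrak a\neq R$, the $F$-pure threshold $\mathrm{fpt}(\mathfrak a)$ is the smallest $\lambda>0$ with $\tau(\mathfrak a^\lambda)\neq R$; moreover $\mathrm{fpt}((0))=0$ and $\mathrm{fpt}(R)=\infty$. Write $\mathrm{fpt}(g)=\mathrm{fpt}((g))$. For a field $k$ of characteristic $p$ and $n\ge 1$, let $\mathcal T_n^\circ(k)\subseteq\mathbb R$ be the set of all $\mathrm{fpt}_0(f)$, where $f\in k[x_1,\dots,x_n]$ satisfies $f(0)=0$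 and $\mathrm{fpt}_0(f)$ is the $F$-pure threshold of the image of $f$ in the local ring $k[x_1,\dots,x_n]_{(x_1,\dots,x_n)}$. Let $\mathcal T_n\subseteq\mathbb R$ be the set of all $\mathrm{fpt}(g)$, where $R$ is a regular domain of characteristic $p$ and Krull dimension at most $n$ whose Frobenius endomorphism is finite, and $g\in R$ is not invertible. **Theorem.** Let $p$ be a prime and let $n\ge 1$. 1. For every field $k$ of characteristic $p$ we have $\mathcal T_n^\circ(k)\subseteq\mathcal T_{n+1}^\circ(k)$. 2. For every extension $K/k$ of fields of characteristic $p$ we have $\mathcal T_n^\circ(k)\subseteq\mathcal T_n^\circ(K)$. 3. If $k$ and $K$ are algebraically closed fields of characteristic $p$, then $\mathcal T_n^\circ(k)=\mathcal T_n^\circ(K)$. Denote this common set by $\mathcal T_n^\circ$. 4. The set $\mathcal T_n$ is contained in the closure of $\mathcal T_n^\circ$ in $\mathbb R$. -/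

import Mathlib

universe u v w

noncomputable section

namespace FPure

/-- The Frobenius power `J^[p^e]`, the ideal generated by all `u ^ (p ^ e)` with `u ∈ J`. -/
def frobPower (p e : ℕ) {R : Type*} [CommRing R] (J : Ideal R) : Ideal R :=
  Ideal.span ((fun u : R => u ^ p ^ e) '' (J : Set R))

/-- The ideal `b^[1/p^e]`, the smallest ideal `J` with `b ≤ J^[p^e]`, written as the
intersection of all such ideals. -/
def frobRoot (p e : ℕ) {R : Type*} [CommRing R] (b : Ideal R) : Ideal R :=
  sInf {J : Ideal R | b ≤ frobPower p e J}

/-- The generalized test ideal `τ(a^c)` for a real exponent `c > 0`. The ideals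
`(a ^ ⌈c p^e⌉)^[1/p^e]` form an ascending chain, so that their supremum is their common value
for all large `e`. -/
def testIdeal (p : ℕ) {R : Type*} [CommRing R] (a : Ideal R) (c : ℝ) : Ideal R :=
  ⨆ e : ℕ, frobRoot p e (a ^ ⌈c * (p : ℝ) ^ e⌉₊)

/-- The `F`-pure threshold of an ideal `a`: the smallest real number `c > 0` with `τ(a^c) ≠ R`.
It is `0` for the zero ideal of a nontrivial ring and `∞` for the unit ideal. -/
def fpt (p : ℕ) {R : Type*} [CommRing R] (a : Ideal R) : EReal :=
  sInf ((fun c : ℝ => (c : EReal)) '' {c : ℝ | 0 < c ∧ testIdeal p a c ≠ ⊤})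

/-- The prime ideal of all polynomials in `k[x₁, …, xₙ]` that vanish at the origin. -/
abbrev originIdeal (n : ℕ) (k : Type*) [Field k] : Ideal (MvPolynomial (Fin n) k) :=
  RingHom.ker (MvPolynomial.constantCoeff : MvPolynomial (Fin n) k →+* k)

instance originIdeal_isPrime (n : ℕ) (k : Type*) [Field k] : (originIdeal n k).IsPrime :=
  RingHom.ker_isPrime _

/-- The local ring `k[x₁, …, xₙ]` localized at `(x₁, …, xₙ)`. -/
abbrev OriginRing (n : ℕ) (k : Type*) [Field k] : Type _ :=
  Localization.AtPrime (originIdeal n k)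

/-- The `F`-pure threshold at the origin of a polynomial `f`. -/
def fptOrigin (p : ℕ) {n : ℕ} {k : Type*} [Field k] (f : MvPolynomial (Fin n) k) : EReal :=
  fpt p (Ideal.span {algebraMap (MvPolynomial (Fin n) k) (OriginRing n k) f})

/-- The set of all `F`-pure thresholds at the origin of polynomials `f ∈ k[x₁, …, xₙ]` with
`f(0) = 0`, where `k` is a field of characteristic `p`. -/
def polyThresholds (p n : ℕ) (k : Type*) [Field k] : Set ℝ :=
  {c : ℝ | ∃ f : MvPolynomial (Fin n) k, MvPolynomial.eval 0 f = 0 ∧ fptOrigin p f = (c : EReal)}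

/-- The set of all `F`-pure thresholds of principal ideals `(g)`, where `g` is a non-unit of an
`F`-finite regular domain of characteristic `p` and of dimension at most `n`. -/
def thresholds (p : ℕ) [Fact p.Prime] (n : ℕ) : Set ℝ :=
  {c : ℝ | ∃ (R : Type u) (_ : CommRing R) (_ : IsDomain R) (_ : CharP R p),
    IsRegularRing R ∧ (frobenius R p).Finite ∧ ringKrullDim R ≤ (n : WithBot ℕ∞) ∧
      ∃ g : R, ¬ IsUnit g ∧ fpt p (Ideal.span {g}) = (c : EReal)}

end FPure

end

noncomputable section

namespace FPure

/-! ### Frobenius powers -/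

section FrobPower

variable {R : Type*} [CommRing R] {p : ℕ}

/-! In a local ring `τ(g^c)` is proper exactly when `g ^ ⌈c p^e⌉ ∈ m^[p^e]` for every `e`. At the
origin of affine space this says that certain coefficients of powers of `f` vanish
(`mem_monPow_iff`), a condition unaffected by adding variables or enlarging the field. This gives
the first two inclusions.

Independence of the algebraically closed field combines specialization with finiteness. Mapping the
ring generated by the coefficients of `f` to another algebraically closed field preserves every
vanishing coefficient, and can be arranged to preserve one nonvanishing coefficient
(`exists_specialization`). Hence the threshold moves by at most `2 / p^e`, for any prescribed `e`.
On the other hand, polynomials of degree at most `D` over perfect fields have only finitely many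
thresholds (`IsJump.mem_thresholdCandidates`). Indeed the ideals `(f^a)^[1/p^e]` with `a ≤ p^e` are
generated in degree at most `D`, so the number of their jumps in `(0, 1]` is bounded by a dimension
count. The jumps are stable under `c ↦ p c - ⌈p c⌉ + 1`, so each has a repeating orbit and lies in
an explicit finite set. For `e` large the specialized threshold must then equal the original one.

For an `F`-finite regular domain, Frobenius is finite and flat, so a proper test ideal is detected
at a maximal ideal (`testIdeal_span_singleton_ne_top_iff_exists`). After localizing there, a
coefficient field modulo a power of the maximal ideal and a regular system of parameters replace `g`
by a polynomial with the same membership conditions up to any fixed level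
(`exists_polynomial_model`). Specializing that polynomial to `k` yields thresholds arbitrarily close
to the given one. -/

theorem frobPower_eq_map [ExpChar R p] (e : ℕ) (J : Ideal R) :
    frobPower p e J = J.map (iterateFrobenius R p e) := rfl

theorem pow_mem_frobPower (e : ℕ) {J : Ideal R} {u : R} (hu : u ∈ J) :
    u ^ p ^ e ∈ frobPower p e J :=
  Ideal.subset_span ⟨u, hu, rfl⟩

theorem frobPower_mono (e : ℕ) {I J : Ideal R} (h : I ≤ J) : frobPower p e I ≤ frobPower p e J :=
  Ideal.span_mono (Set.image_mono h)

theorem frobPower_map [ExpChar R p] {S : Type*} [CommRing S] [ExpChar S p] (φ : R →+* S) (e : ℕ)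
    (J : Ideal R) : frobPower p e (J.map φ) = (frobPower p e J).map φ := by
  rw [frobPower_eq_map, frobPower_eq_map, Ideal.map_map, Ideal.map_map]
  congr 1
  ext x
  simp [iterateFrobenius_def]

theorem frobPower_span_range [ExpChar R p] {ι : Type*} (x : ι → R) (e : ℕ) :
    frobPower p e (Ideal.span (Set.range x)) = Ideal.span (Set.range fun i => x i ^ p ^ e) := by
  rw [frobPower_eq_map, Ideal.map_span, ← Set.range_comp]
  rfl

theorem frobRoot_le {b J : Ideal R} {e : ℕ} (h : b ≤ frobPower p e J) : frobRoot p e b ≤ J :=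
  sInf_le h

/-- Any proper ideal competing in the intersection lies in the maximal ideal, so the maximal ideal
competes as well. Flatness of Frobenius plays no role here. -/
theorem frobRoot_ne_top_iff [IsLocalRing R] {b : Ideal R} {e : ℕ} :
    frobRoot p e b ≠ ⊤ ↔ b ≤ frobPower p e (IsLocalRing.maximalIdeal R) := by
  constructor
  · intro h
    by_contra hb
    refine h (sInf_eq_top.2 fun J hJ => ?_)
    by_contra hJ'
    exact hb (le_trans hJ (frobPower_mono e (IsLocalRing.le_maximalIdeal hJ')))
  · intro h h'
    have := frobRoot_le h
    rw [h', top_le_iff] at this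
    exact Ideal.IsPrime.ne_top' this

theorem testIdeal_span_singleton_ne_top_iff [IsLocalRing R] (g : R) (c : ℝ) :
    testIdeal p (Ideal.span {g}) c ≠ ⊤ ↔
      ∀ e : ℕ, g ^ ⌈c * (p : ℝ) ^ e⌉₊ ∈ frobPower p e (IsLocalRing.maximalIdeal R) := by
  have key : ∀ e : ℕ, g ^ ⌈c * (p : ℝ) ^ e⌉₊ ∈ frobPower p e (IsLocalRing.maximalIdeal R) ↔
      frobRoot p e (Ideal.span {g} ^ ⌈c * (p : ℝ) ^ e⌉₊) ≤ IsLocalRing.maximalIdeal R := by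
    intro e
    constructor
    · intro h
      refine frobRoot_le ?_
      rwa [Ideal.span_singleton_pow, Ideal.span_singleton_le_iff_mem]
    · intro h
      have : frobRoot p e (Ideal.span {g} ^ ⌈c * (p : ℝ) ^ e⌉₊) ≠ ⊤ := by
        intro h'
        rw [h', top_le_iff] at h
        exact Ideal.IsPrime.ne_top' h
      rwa [frobRoot_ne_top_iff, Ideal.span_singleton_pow, Ideal.span_singleton_le_iff_mem] at this
  simp only [key]
  rw [← iSup_le_iff]
  exact ⟨IsLocalRing.le_maximalIdeal, fun h h' => Ideal.IsPrime.ne_top'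
    (top_le_iff.1 (h'.symm.le.trans h))⟩

/-- Membership in the Frobenius power of a maximal ideal can be tested after localizing. -/
theorem algebraMap_mem_frobPower_maximalIdeal_iff [ExpChar R p] (m : Ideal R) [hm : m.IsMaximal]
    (S : Type*) [CommRing S] [IsLocalRing S] [ExpChar S p] [Algebra R S]
    [IsLocalization.AtPrime S m] (e : ℕ) (h : R) :
    algebraMap R S h ∈ frobPower p e (IsLocalRing.maximalIdeal S) ↔ h ∈ frobPower p e m := by
  rw [← IsLocalization.AtPrime.map_eq_maximalIdeal m S, frobPower_map]
  refine ⟨fun hh => ?_, Ideal.mem_map_of_mem _⟩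
  obtain ⟨s, hs, hsh⟩ := (IsLocalization.algebraMap_mem_map_algebraMap_iff m.primeCompl S _ _).1 hh
  obtain ⟨r, y, hy, hry⟩ := hm.exists_inv hs
  have h1 : r ^ p ^ e * s ^ p ^ e + y ^ p ^ e = 1 := by
    rw [← mul_pow, ← add_pow_expChar_pow, hry, one_pow]
  -- The Frobenius power of `r s + y = 1` writes `h` as a combination of `s h` and `y ^ p ^ e`, both
  -- in the ideal.
  have h2 : h = r ^ p ^ e * s ^ (p ^ e - 1) * (s * h) + h * y ^ p ^ e := by
    have : s ^ (p ^ e - 1) * s = s ^ p ^ e :=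
      pow_sub_one_mul (pow_ne_zero _ (expChar_pos R p).ne') _
    linear_combination (-h) * h1 + (- r ^ p ^ e * h) * this
  rw [h2]
  exact add_mem (Ideal.mul_mem_left _ _ hsh) (Ideal.mul_mem_left _ _ (pow_mem_frobPower e hy))

end FrobPower

/-! ### The threshold of a family of conditions -/

section Threshold

variable (p : ℕ)

/-- The positive reals `c` such that `P e ⌈c p^e⌉` for all `e`. -/
def expSet (P : ℕ → ℕ → Prop) : Set ℝ := {c : ℝ | 0 < c ∧ ∀ e : ℕ, P e ⌈c * (p : ℝ) ^ e⌉₊}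

variable {p} {P : ℕ → ℕ → Prop}

theorem expSet_mono (hP : ∀ e a b, a ≤ b → P e a → P e b) {c d : ℝ} (hc : c ∈ expSet p P)
    (h : c ≤ d) : d ∈ expSet p P :=
  ⟨hc.1.trans_le h, fun e => hP e _ _ (Nat.ceil_mono (by gcongr)) (hc.2 e)⟩

theorem fpt_span_singleton {R : Type*} [CommRing R] [IsLocalRing R] (g : R) :
    fpt p (Ideal.span {g}) = sInf ((fun c : ℝ => (c : EReal)) ''
      expSet p fun e a => g ^ a ∈ frobPower p e (IsLocalRing.maximalIdeal R)) := by
  unfold fpt expSet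
  simp only [testIdeal_span_singleton_ne_top_iff]

/-- The infimum in `EReal` of a set of reals is a real number exactly when it is the greatest
lower bound of the set. -/
theorem sInf_coe_image_eq_iff {C : Set ℝ} {c : ℝ} :
    sInf ((fun c : ℝ => (c : EReal)) '' C) = (c : EReal) ↔ IsGLB C c := by
  constructor
  · intro h
    refine ⟨fun d hd => ?_, fun d hd => ?_⟩
    · exact EReal.coe_le_coe_iff.1 (h ▸ sInf_le ⟨d, hd, rfl⟩)
    · rw [← EReal.coe_le_coe_iff, ← h]
      refine le_sInf ?_
      rintro _ ⟨x, hx, rfl⟩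
      exact EReal.coe_le_coe_iff.2 (hd hx)
  · intro h
    refine le_antisymm ?_ (le_sInf ?_)
    · by_contra hlt
      rw [not_le] at hlt
      obtain ⟨y, hy1, hy2⟩ := EReal.lt_iff_exists_real_btwn.1 hlt
      refine absurd (h.2 (show y ∈ lowerBounds C from fun x hx => ?_))
        (not_le.2 (EReal.coe_lt_coe_iff.1 hy1))
      exact EReal.coe_le_coe_iff.1 (hy2.le.trans (sInf_le ⟨x, hx, rfl⟩))
    · rintro _ ⟨x, hx, rfl⟩
      exact EReal.coe_le_coe_iff.2 (h.1 hx)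

end Threshold

/-! ### Thresholds of polynomials at the origin -/

section Mon

open MvPolynomial

/-- The ideal `(x₁^q, …, xₙ^q)` of the polynomial ring. -/
def monPow (n : ℕ) (k : Type*) [Field k] (q : ℕ) : Ideal (MvPolynomial (Fin n) k) :=
  Ideal.span (Set.range fun i => X i ^ q)

variable {n : ℕ} {k : Type*} [Field k]

theorem mem_monPow_iff {q : ℕ} {f : MvPolynomial (Fin n) k} :
    f ∈ monPow n k q ↔ ∀ u : Fin n →₀ ℕ, (∀ i, u i < q) → coeff u f = 0 := by
  have : monPow n k q = Ideal.span ((fun s => monomial s (1 : k)) ''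
      Set.range fun i : Fin n => Finsupp.single i q) := by
    rw [← Set.range_comp, monPow]
    congr 2
    ext1 i
    simp [X_pow_eq_monomial]
  rw [this, mem_ideal_span_monomial_image]
  refine forall_congr' fun u => ?_
  rw [mem_support_iff]
  constructor
  · intro h hu
    by_contra hc
    obtain ⟨_, ⟨i, rfl⟩, hi⟩ := h hc
    have := hi i
    rw [Finsupp.single_eq_same] at this
    exact absurd (hu i) (not_lt.2 this)
  · intro h hc
    by_contra hcon
    refine hc (h fun i => ?_)
    by_contra hi
    refine hcon ⟨_, ⟨i, rfl⟩, ?_⟩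
    rw [Finsupp.single_le_iff]
    exact not_lt.1 hi

theorem originIdeal_eq_span (n : ℕ) (k : Type*) [Field k] :
    originIdeal n k = Ideal.span (Set.range X) := by
  have h : Ideal.span (Set.range (X : Fin n → MvPolynomial (Fin n) k)) = monPow n k 1 := by
    simp [monPow]
  rw [h]
  ext f
  rw [RingHom.mem_ker, mem_monPow_iff]
  constructor
  · intro hf u hu
    have : u = 0 := by
      ext i
      simpa using hu i
    rw [this]
    exact hf
  · intro hf
    exact hf 0 fun i => by simp

instance originIdeal_isMaximal (n : ℕ) (k : Type*) [Field k] : (originIdeal n k).IsMaximal :=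
  RingHom.ker_isMaximal_of_surjective _ fun a => ⟨C a, constantCoeff_C _ a⟩

theorem charP_originRing (p n : ℕ) (k : Type*) [Field k] [CharP k p] :
    CharP (OriginRing n k) p :=
  charP_of_injective_algebraMap (IsLocalization.injective (OriginRing n k)
    (originIdeal n k).primeCompl_le_nonZeroDivisors) p

variable {p : ℕ} [Fact p.Prime]

theorem algebraMap_mem_frobPower_origin_iff [CharP k p] (e : ℕ) (f : MvPolynomial (Fin n) k) :
    algebraMap _ (OriginRing n k) f ∈
      frobPower p e (IsLocalRing.maximalIdeal (OriginRing n k)) ↔ f ∈ monPow n k (p ^ e) := by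
  have := charP_originRing p n k
  rw [algebraMap_mem_frobPower_maximalIdeal_iff (originIdeal n k), originIdeal_eq_span,
    frobPower_span_range]
  rfl

theorem fptOrigin_eq_coe_iff [CharP k p] (f : MvPolynomial (Fin n) k) (c : ℝ) :
    fptOrigin p f = (c : EReal) ↔
      IsGLB (expSet p fun e a => f ^ a ∈ monPow n k (p ^ e)) c := by
  have := charP_originRing p n k
  rw [fptOrigin, fpt_span_singleton, sInf_coe_image_eq_iff]
  simp only [← map_pow, algebraMap_mem_frobPower_origin_iff]

theorem eval_zero_eq_zero_of_pow_mem {f : MvPolynomial (Fin n) k} {a q : ℕ} (hq : 0 < q)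
    (h : f ^ a ∈ monPow n k q) : eval 0 f = 0 := by
  rw [mem_monPow_iff] at h
  have h0 := h 0 fun i => hq
  rw [← constantCoeff_eq, map_pow] at h0
  rw [eval_zero]
  exact eq_zero_of_pow_eq_zero h0

theorem map_mem_monPow_iff {K : Type*} [Field K] (φ : k →+* K) {q : ℕ}
    (f : MvPolynomial (Fin n) k) : map φ f ∈ monPow n K q ↔ f ∈ monPow n k q := by
  simp only [mem_monPow_iff, coeff_map, map_eq_zero]

theorem rename_mem_monPow_iff {m q : ℕ} (hq : 0 < q) (ι : Fin n ↪ Fin m)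
    (f : MvPolynomial (Fin n) k) : rename ι f ∈ monPow m k q ↔ f ∈ monPow n k q := by
  simp only [mem_monPow_iff]
  constructor
  · intro h u hu
    rw [← coeff_rename_mapDomain ι ι.injective]
    refine h _ fun j => ?_
    by_cases hj : j ∈ Set.range ι
    · obtain ⟨i, rfl⟩ := hj
      rw [Finsupp.mapDomain_apply ι.injective]
      exact hu i
    · rwa [Finsupp.mapDomain_of_notMem_range _ _ hj]
  · intro h u hu
    by_contra hc
    obtain ⟨v, rfl, hv⟩ := coeff_rename_ne_zero _ _ _ hc
    refine hv (h v fun i => ?_)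
    have := hu (ι i)
    rwa [Finsupp.mapDomain_apply ι.injective] at this

theorem mem_polyThresholds_iff [CharP k p] {c : ℝ} : c ∈ polyThresholds p n k ↔
    ∃ f : MvPolynomial (Fin n) k, eval 0 f = 0 ∧
      IsGLB (expSet p fun e a => f ^ a ∈ monPow n k (p ^ e)) c := by
  simp only [polyThresholds, Set.mem_ofPred_eq, fptOrigin_eq_coe_iff]

theorem polyThresholds_subset_of_embedding [CharP k p] {m : ℕ} (ι : Fin n ↪ Fin m) :
    polyThresholds p n k ⊆ polyThresholds p m k := by
  intro c hc
  rw [mem_polyThresholds_iff] at hc ⊢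
  obtain ⟨f, hf, hc⟩ := hc
  refine ⟨rename ι f, ?_, ?_⟩
  · rw [eval_zero] at hf ⊢
    rwa [constantCoeff_rename]
  · simpa only [← map_pow, rename_mem_monPow_iff (pow_pos (Fact.out : p.Prime).pos _)] using hc

theorem polyThresholds_subset_of_ringHom [CharP k p] {K : Type*} [Field K] [CharP K p]
    (φ : k →+* K) : polyThresholds p n k ⊆ polyThresholds p n K := by
  intro c hc
  rw [mem_polyThresholds_iff] at hc ⊢
  obtain ⟨f, hf, hc⟩ := hc
  refine ⟨map φ f, ?_, ?_⟩
  · rw [eval_zero] at hf ⊢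
    rw [constantCoeff_map, hf, map_zero]
  · simpa only [← map_pow, map_mem_monPow_iff] using hc

theorem coeff_smul_pow_char [CharP k p] (f : MvPolynomial (Fin n) k) (u : Fin n →₀ ℕ) :
    coeff (p • u) (f ^ p) = coeff u f ^ p := by
  rw [← map_frobenius_expand p, coeff_map, coeff_expand_smul _ (Fact.out : p.Prime).ne_zero]
  rfl

theorem coeff_pow_char_of_not_dvd [CharP k p] (f : MvPolynomial (Fin n) k) {u : Fin n →₀ ℕ}
    {i : Fin n} (h : ¬ p ∣ u i) : coeff u (f ^ p) = 0 := by
  rw [← map_frobenius_expand p, coeff_map]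
  exact (congrArg _ (coeff_expand_of_not_dvd (φ := f) h)).trans (map_zero _)

/-- The exponents of `f ^ p` are `p` times those of `f`, and the coefficients are `p`-th powers.
This is what links the conditions at different levels `e`. -/
theorem pow_char_mem_monPow_iff [CharP k p] {q : ℕ} {f : MvPolynomial (Fin n) k} :
    f ^ p ∈ monPow n k (p * q) ↔ f ∈ monPow n k q := by
  have hp := (Fact.out : p.Prime).pos
  simp only [mem_monPow_iff]
  constructor
  · intro h u hu
    have := h (p • u) fun i => by simpa using Nat.mul_lt_mul_of_pos_left (hu i) hp
    rw [coeff_smul_pow_char] at this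
    exact eq_zero_of_pow_eq_zero this
  · intro h u hu
    by_cases hd : ∀ i, p ∣ u i
    · choose v hv using hd
      have huv : u = p • Finsupp.equivFunOnFinite.symm v := by
        ext i
        simp [hv i]
      rw [huv, coeff_smul_pow_char, h, zero_pow hp.ne']
      intro i
      have := hu i
      rw [hv i] at this
      simpa using lt_of_mul_lt_mul_left this (Nat.zero_le p)
    · push Not at hd
      obtain ⟨i, hi⟩ := hd
      exact coeff_pow_char_of_not_dvd f hi

theorem pow_char_pow_mem_monPow_iff [CharP k p] {q : ℕ} (e : ℕ) {f : MvPolynomial (Fin n) k} :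
    f ^ p ^ e ∈ monPow n k (p ^ e * q) ↔ f ∈ monPow n k q := by
  induction e with
  | zero => simp
  | succ e ih => rw [pow_succ, pow_mul, mul_assoc, mul_left_comm, pow_char_mem_monPow_iff, ih]

theorem one_notMem_monPow {q : ℕ} (hq : 0 < q) : (1 : MvPolynomial (Fin n) k) ∉ monPow n k q :=
  fun h => by
    have := mem_monPow_iff.1 h 0 fun i => by simpa using hq
    simp at this

theorem pow_mem_monPow_mono {q : ℕ} {f : MvPolynomial (Fin n) k} {a b : ℕ} (h : a ≤ b)
    (ha : f ^ a ∈ monPow n k q) : f ^ b ∈ monPow n k q :=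
  Ideal.mem_of_dvd _ (pow_dvd_pow f h) ha

/-- The exponents `c > 0` with `f ^ ⌈c p^e⌉ ∈ (x₁^(p^e), …, xₙ^(p^e))` for all `e`. -/
def polyExpSet (p : ℕ) {n : ℕ} {k : Type*} [Field k] (f : MvPolynomial (Fin n) k) : Set ℝ :=
  expSet p fun e a => f ^ a ∈ monPow n k (p ^ e)

omit [Fact p.Prime] in
theorem polyExpSet_mono {f : MvPolynomial (Fin n) k} {c d : ℝ} (hc : c ∈ polyExpSet p f)
    (h : c ≤ d) : d ∈ polyExpSet p f :=
  expSet_mono (P := fun e a => f ^ a ∈ monPow n k (p ^ e))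
    (fun _ _ _ hab h => pow_mem_monPow_mono hab h) hc h

/-- For an exponent with denominator `p^e`, level `e` alone decides: higher levels are its Frobenius
powers, and lower ones follow by cancelling Frobenius after rounding the exponent up. -/
theorem div_mem_polyExpSet_iff [CharP k p] {f : MvPolynomial (Fin n) k} {e a : ℕ} (ha : 0 < a) :
    (a / (p : ℝ) ^ e) ∈ polyExpSet p f ↔ f ^ a ∈ monPow n k (p ^ e) := by
  have hp := (Fact.out : p.Prime).pos
  have hpe : (0 : ℝ) < (p : ℝ) ^ e := by positivity
  constructor
  · intro h
    have := h.2 e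
    rwa [div_mul_cancel₀ _ hpe.ne', Nat.ceil_natCast] at this
  · intro h
    refine ⟨by positivity, fun e' => ?_⟩
    rcases le_total e e' with hle | hle
    · obtain ⟨d, rfl⟩ := Nat.exists_eq_add_of_le hle
      have h1 : a / (p : ℝ) ^ e * (p : ℝ) ^ (e + d) = ((a * p ^ d : ℕ) : ℝ) := by
        push_cast
        field_simp
        ring
      rw [h1, Nat.ceil_natCast, pow_mul, add_comm, pow_add, pow_char_pow_mem_monPow_iff]
      exact h
    · obtain ⟨d, rfl⟩ := Nat.exists_eq_add_of_le hle
      rw [← pow_char_pow_mem_monPow_iff d, ← pow_mul, ← pow_add, add_comm d]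
      refine pow_mem_monPow_mono ?_ h
      rw [← Nat.cast_le (α := ℝ)]
      push_cast
      calc (a : ℝ) = a / (p : ℝ) ^ (e' + d) * (p : ℝ) ^ e' * (p : ℝ) ^ d := by
            field_simp
            ring
        _ ≤ _ := by
            gcongr
            exact Nat.le_ceil _

theorem pow_notMem_monPow_of_lt [CharP k p] {f : MvPolynomial (Fin n) k} {c : ℝ}
    (hc : IsGLB (polyExpSet p f) c) {e a : ℕ} (h : a / (p : ℝ) ^ e < c) :
    f ^ a ∉ monPow n k (p ^ e) := by
  intro hmem
  rcases Nat.eq_zero_or_pos a with rfl | ha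
  · exact one_notMem_monPow (pow_pos (Fact.out : p.Prime).pos e) (by simpa using hmem)
  · exact not_le.2 h (hc.1 ((div_mem_polyExpSet_iff ha).2 hmem))

theorem pow_mem_monPow_of_lt [CharP k p] {f : MvPolynomial (Fin n) k} {c : ℝ}
    (hc : IsGLB (polyExpSet p f) c) (hc0 : 0 ≤ c) {e a : ℕ} (h : c < a / (p : ℝ) ^ e) :
    f ^ a ∈ monPow n k (p ^ e) := by
  have ha : 0 < a := by
    rcases Nat.eq_zero_or_pos a with rfl | ha
    · simp only [Nat.cast_zero, zero_div] at h
      exact absurd h (not_lt.2 hc0)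
    · exact ha
  rw [← div_mem_polyExpSet_iff ha]
  obtain ⟨d, hd, _, hd'⟩ := hc.exists_between h
  exact polyExpSet_mono hd hd'.le

omit [Fact p.Prime] in
theorem nonneg_of_isGLB_polyExpSet {f : MvPolynomial (Fin n) k} {c : ℝ}
    (hc : IsGLB (polyExpSet p f) c) : 0 ≤ c :=
  hc.2 fun _ hd => hd.1.le

theorem one_mem_polyExpSet [CharP k p] {f : MvPolynomial (Fin n) k} (hf : eval 0 f = 0) :
    1 ∈ polyExpSet p f := by
  have := div_mem_polyExpSet_iff (p := p) (f := f) (e := 0) zero_lt_one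
  rw [pow_zero, div_one, Nat.cast_one, pow_one, pow_zero] at this
  rw [this, mem_monPow_iff]
  intro u hu
  have : u = 0 := by
    ext i
    simpa using hu i
  rwa [this, ← constantCoeff_eq, ← eval_zero]

theorem exists_isGLB_polyExpSet [CharP k p] {f : MvPolynomial (Fin n) k} (hf : eval 0 f = 0) :
    ∃ c, IsGLB (polyExpSet p f) c :=
  ⟨_, isGLB_csInf ⟨1, one_mem_polyExpSet hf⟩ ⟨0, fun _ hd => hd.1.le⟩⟩

omit [Fact p.Prime] in
theorem le_of_pow_ceil_notMem {f : MvPolynomial (Fin n) k} {c d : ℝ}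
    (hc : IsGLB (polyExpSet p f) c) {e : ℕ} (h : f ^ ⌈d * (p : ℝ) ^ e⌉₊ ∉ monPow n k (p ^ e)) :
    d ≤ c := by
  by_contra hlt
  obtain ⟨x, hx, _, hxd⟩ := hc.exists_between (not_le.1 hlt)
  exact h ((polyExpSet_mono hx hxd.le).2 e)

theorem le_div_of_pow_mem [CharP k p] {f : MvPolynomial (Fin n) k} {c : ℝ}
    (hc : IsGLB (polyExpSet p f) c) {e a : ℕ} (ha : 0 < a) (h : f ^ a ∈ monPow n k (p ^ e)) :
    c ≤ a / (p : ℝ) ^ e :=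
  hc.1 ((div_mem_polyExpSet_iff ha).2 h)

theorem zero_mem_polyThresholds [CharP k p] : 0 ∈ polyThresholds p n k := by
  rw [mem_polyThresholds_iff]
  refine ⟨0, by simp, ?_⟩
  have hp := (Fact.out : p.Prime).pos
  have : (expSet p fun e a => (0 : MvPolynomial (Fin n) k) ^ a ∈ monPow n k (p ^ e)) =
      Set.Ioi 0 := by
    ext c
    refine ⟨fun h => h.1, fun h => ⟨h, fun e => ?_⟩⟩
    have : 0 < ⌈c * (p : ℝ) ^ e⌉₊ := by
      rw [Nat.ceil_pos]
      have : (0 : ℝ) < c := h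
      positivity
    show (0 : MvPolynomial (Fin n) k) ^ _ ∈ _
    rw [zero_pow this.ne']
    exact zero_mem _
  rw [this]
  exact isGLB_Ioi

end Mon

/-! ### Specialization of polynomials -/

section Specialization

open MvPolynomial

/-- A nonzero element of a finitely generated domain over `𝔽_p` is not killed by some
homomorphism to a given algebraically closed field of characteristic `p`. -/
theorem exists_ringHom_ne_zero {p : ℕ} [Fact p.Prime] {A : Type*} [CommRing A] [IsDomain A]
    [Algebra (ZMod p) A] [Algebra.FiniteType (ZMod p) A] (k : Type*) [Field k] [CharP k p]
    [IsAlgClosed k] {c : A} (hc : c ≠ 0) : ∃ φ : A →+* k, φ c ≠ 0 := by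
  -- By the Nullstellensatz some maximal ideal avoids `c`; its residue field is finite over `𝔽_p`
  -- and so embeds in `k`.
  have hJ : IsJacobsonRing A := isJacobsonRing_of_finiteType (A := ZMod p)
  have hbot : (⊥ : Ideal A).jacobson = ⊥ :=
    isJacobsonRing_iff.1 hJ _ Ideal.isPrime_bot.isRadical
  have hcj : c ∉ (⊥ : Ideal A).jacobson := by
    rw [hbot]
    exact hc
  rw [Ideal.jacobson, Ideal.mem_sInf] at hcj
  push Not at hcj
  obtain ⟨M, ⟨-, hM⟩, hcM⟩ := hcj
  let _ := Ideal.Quotient.field M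
  have : Module.Finite (ZMod p) (A ⧸ M) := finite_of_finite_type_of_isJacobsonRing _ _
  let _ : Algebra (ZMod p) k := ZMod.algebra k p
  let ψ : A ⧸ M →ₐ[ZMod p] k := IsAlgClosed.lift
  refine ⟨(ψ : A ⧸ M →+* k).comp (Ideal.Quotient.mk M), fun h => hcM ?_⟩
  rw [RingHom.comp_apply, map_eq_zero] at h
  exact Ideal.Quotient.eq_zero_iff_mem.1 h

/-- Memberships in `monPow` are vanishing statements and survive every homomorphism from the ring of
coefficients; the single non-membership survives once one witnessing coefficient is kept nonzero. -/
theorem exists_specialization {p n : ℕ} [Fact p.Prime] {κ : Type*} [Field κ] [CharP κ p]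
    (k : Type*) [Field k] [CharP k p] [IsAlgClosed k] (f : MvPolynomial (Fin n) κ) {a q : ℕ}
    (hf : f ^ a ∉ monPow n κ q) :
    ∃ f' : MvPolynomial (Fin n) k, f'.totalDegree ≤ f.totalDegree ∧ f' ^ a ∉ monPow n k q ∧
      ∀ b r : ℕ, f ^ b ∈ monPow n κ r → f' ^ b ∈ monPow n k r := by
  let _ : Algebra (ZMod p) κ := ZMod.algebra κ p
  let A := Algebra.adjoin (ZMod p) (f.coeffs : Set κ)
  have : Algebra.FiniteType (ZMod p) A :=
    (Subalgebra.fg_iff_finiteType A).1 ⟨f.coeffs, rfl⟩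
  obtain ⟨F, hF⟩ : ∃ F : MvPolynomial (Fin n) A, map A.val.toRingHom F = f := by
    have := (mem_range_map_iff_coeffs_subset (f := A.val.toRingHom) (x := f)).2 ?_
    · exact this
    · intro x hx
      exact ⟨⟨x, Algebra.subset_adjoin hx⟩, rfl⟩
  have hinj : Function.Injective A.val.toRingHom := Subtype.val_injective
  have hco : ∀ b u, coeff u (f ^ b) = A.val.toRingHom (coeff u (F ^ b)) := by
    intro b u
    rw [← hF, ← map_pow, coeff_map]
  rw [mem_monPow_iff] at hf
  push Not at hf
  obtain ⟨u, hu, hc⟩ := hf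
  have hc' : coeff u (F ^ a) ≠ 0 := by
    intro h
    rw [hco, h, map_zero] at hc
    exact hc rfl
  obtain ⟨φ, hφ⟩ := exists_ringHom_ne_zero (p := p) k hc'
  refine ⟨map φ F, ?_, ?_, ?_⟩
  · rw [← hF, totalDegree, totalDegree, support_map_of_injective F hinj]
    exact Finset.sup_mono (support_map_subset φ F)
  · rw [mem_monPow_iff, ← map_pow]
    intro h
    exact hφ (by rw [← coeff_map, h u hu])
  · intro b r hb
    rw [mem_monPow_iff] at hb ⊢
    intro v hv
    have := hb v hv
    rw [hco, map_eq_zero_iff _ hinj] at this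
    rw [← map_pow, coeff_map, this, map_zero]

end Specialization

/-! ### Cartier operators on polynomial rings over perfect fields -/

section Cartier

open MvPolynomial

variable {p : ℕ} [Fact p.Prime] {n : ℕ} {k : Type*} [Field k] [CharP k p] [PerfectRing k p]

/-- The exponent vector of a family of residues modulo `p`. -/
def residueExp (v : Fin n → Fin p) : Fin n →₀ ℕ :=
  Finsupp.equivFunOnFinite.symm fun i => (v i : ℕ)

/-- The residues modulo `p` of an exponent vector. -/
def expResidue (p : ℕ) [Fact p.Prime] (u : Fin n →₀ ℕ) : Fin n → Fin p := fun i =>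
  ⟨u i % p, Nat.mod_lt _ (Fact.out : p.Prime).pos⟩

/-- The componentwise quotient of an exponent vector by `p`. -/
def expDiv (p : ℕ) (u : Fin n →₀ ℕ) : Fin n →₀ ℕ := Finsupp.equivFunOnFinite.symm fun i => u i / p

theorem smul_expDiv_add_residueExp (u : Fin n →₀ ℕ) :
    p • expDiv p u + residueExp (expResidue p u) = u := by
  ext i
  simp [expDiv, residueExp, expResidue, Nat.div_add_mod]

theorem expDiv_smul_add (w u : Fin n →₀ ℕ) : expDiv p (p • w + u) = w + expDiv p u := by
  ext i
  simp [expDiv, Nat.mul_add_div (Fact.out : p.Prime).pos]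

theorem expResidue_smul_add (w u : Fin n →₀ ℕ) : expResidue p (p • w + u) = expResidue p u := by
  ext i
  simp [expResidue]

omit [Fact p.Prime] in
theorem expDiv_residueExp (v : Fin n → Fin p) : expDiv p (residueExp v) = 0 := by
  ext i
  simp [expDiv, residueExp]

theorem expResidue_residueExp (v : Fin n → Fin p) : expResidue p (residueExp v) = v := by
  ext i
  simp [expResidue, residueExp, Nat.mod_eq_of_lt]

theorem smul_add_residueExp_eq_iff {m u : Fin n →₀ ℕ} {v : Fin n → Fin p} :
    p • m + residueExp v = u ↔ m = expDiv p u ∧ v = expResidue p u := by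
  constructor
  · rintro rfl
    rw [expDiv_smul_add, expResidue_smul_add, expDiv_residueExp, expResidue_residueExp]
    simp
  · rintro ⟨rfl, rfl⟩
    exact smul_expDiv_add_residueExp u

/-- The Cartier operators: `h = ∑ v, x ^ v * (cartier v h) ^ p`. -/
def cartier (v : Fin n → Fin p) (h : MvPolynomial (Fin n) k) : MvPolynomial (Fin n) k :=
  ∑ m ∈ h.support.image (expDiv p),
    monomial m ((frobeniusEquiv k p).symm (coeff (p • m + residueExp v) h))

theorem coeff_cartier (v : Fin n → Fin p) (h : MvPolynomial (Fin n) k) (m : Fin n →₀ ℕ) :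
    coeff m (cartier v h) = (frobeniusEquiv k p).symm (coeff (p • m + residueExp v) h) := by
  classical
  simp only [cartier, coeff_sum, coeff_monomial, Finset.sum_ite_eq']
  split_ifs with hm
  · rfl
  · symm
    rw [map_eq_zero_iff _ (RingEquiv.injective _)]
    by_contra hc
    refine hm (Finset.mem_image.2 ⟨_, mem_support_iff.2 hc, ?_⟩)
    rw [expDiv_smul_add, expDiv_residueExp, add_zero]

theorem cartier_add (v : Fin n → Fin p) (g h : MvPolynomial (Fin n) k) :
    cartier v (g + h) = cartier v g + cartier v h := by
  ext m
  simp [coeff_cartier]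

/-- The Cartier operator as an additive map. -/
def cartierHom (v : Fin n → Fin p) : MvPolynomial (Fin n) k →+ MvPolynomial (Fin n) k :=
  AddMonoidHom.mk' (cartier v) (cartier_add v)

theorem cartier_sum (v : Fin n → Fin p) {ι : Type*} (s : Finset ι)
    (h : ι → MvPolynomial (Fin n) k) :
    cartier v (∑ i ∈ s, h i) = ∑ i ∈ s, cartier v (h i) :=
  map_sum (cartierHom v) h s

theorem cartier_monomial (v : Fin n → Fin p) (u : Fin n →₀ ℕ) (c : k) :
    cartier v (monomial u c) = if v = expResidue p u then
      monomial (expDiv p u) ((frobeniusEquiv k p).symm c) else 0 := by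
  classical
  ext m
  rw [coeff_cartier, coeff_monomial]
  simp only [eq_comm (a := u), smul_add_residueExp_eq_iff]
  by_cases hv : v = expResidue p u
  · rw [if_pos hv, coeff_monomial]
    simp only [hv, and_true, eq_comm (a := m)]
    split_ifs <;> simp
  · simp [hv]

theorem cartier_pow_mul (v : Fin n → Fin p) (g h : MvPolynomial (Fin n) k) :
    cartier v (g ^ p * h) = g * cartier v h := by
  induction g using induction_on' with
  | add g g' hg hg' => rw [add_pow_char, add_mul, cartier_add, hg, hg', add_mul]
  | monomial w c =>
    induction h using induction_on' with
    | add h h' hh hh' => rw [mul_add, cartier_add, hh, hh', cartier_add, mul_add]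
    | monomial u d =>
      rw [monomial_pow, monomial_mul, cartier_monomial, cartier_monomial, expResidue_smul_add]
      split_ifs
      · rw [monomial_mul, expDiv_smul_add, map_mul, frobeniusEquiv_symm_pow]
      · rw [mul_zero]

theorem sum_cartier (h : MvPolynomial (Fin n) k) :
    ∑ v : Fin n → Fin p, monomial (residueExp v) 1 * cartier v h ^ p = h := by
  classical
  induction h using induction_on' with
  | monomial u c =>
    rw [Finset.sum_eq_single (expResidue p u)]
    · rw [cartier_monomial, if_pos rfl, monomial_pow, monomial_mul, one_mul, add_comm,
        smul_expDiv_add_residueExp]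
      congr 1
      exact (frobeniusEquiv k p).apply_symm_apply c
    · intro v _ hv
      rw [cartier_monomial, if_neg hv, zero_pow (Fact.out : p.Prime).ne_zero, mul_zero]
    · simp
  | add g h hg hh =>
    conv_rhs => rw [← hg, ← hh]
    rw [← Finset.sum_add_distrib]
    refine Finset.sum_congr rfl fun v _ => ?_
    rw [cartier_add, add_pow_char, mul_add]

/-- The exponent `m` in the image comes from `p m + v`. This division by `p` offsets the growth of
the degree of `f ^ a` and makes a finite-dimensional argument possible. -/
theorem totalDegree_cartier_le (v : Fin n → Fin p) (h : MvPolynomial (Fin n) k) :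
    (cartier v h).totalDegree ≤ h.totalDegree / p := by
  rw [totalDegree, Finset.sup_le_iff]
  intro m hm
  rw [mem_support_iff, coeff_cartier, Ne, map_eq_zero_iff _ (RingEquiv.injective _)] at hm
  have h1 := le_totalDegree (mem_support_iff.2 hm)
  rw [Nat.le_div_iff_mul_le (Fact.out : p.Prime).pos]
  refine le_trans ?_ h1
  rw [Finsupp.sum_add_index' (fun _ => rfl) (fun _ _ _ => rfl),
    Finsupp.sum_smul_index' (fun _ => rfl)]
  refine le_trans (le_of_eq ?_) (Nat.le_add_right _ _)
  rw [Finsupp.sum, Finsupp.sum, Finset.sum_mul]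
  exact Finset.sum_congr rfl fun i _ => by rw [smul_eq_mul, mul_comm]

/-- The ideal generated by the images of `J` under the Cartier operators. -/
def cartierIdeal (p : ℕ) [Fact p.Prime] [CharP k p] [PerfectRing k p]
    (J : Ideal (MvPolynomial (Fin n) k)) : Ideal (MvPolynomial (Fin n) k) :=
  Ideal.span {g | ∃ v : Fin n → Fin p, ∃ h ∈ J, cartier v h = g}

theorem cartier_mem_cartierIdeal (v : Fin n → Fin p) {J : Ideal (MvPolynomial (Fin n) k)}
    {h : MvPolynomial (Fin n) k} (hh : h ∈ J) : cartier v h ∈ cartierIdeal p J :=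
  Ideal.subset_span ⟨v, h, hh, rfl⟩

theorem cartierIdeal_le_iff {J J' : Ideal (MvPolynomial (Fin n) k)} :
    cartierIdeal p J ≤ J' ↔ ∀ (v : Fin n → Fin p), ∀ h ∈ J, cartier v h ∈ J' := by
  rw [cartierIdeal, Ideal.span_le]
  constructor
  · exact fun H v h hh => H ⟨v, h, hh, rfl⟩
  · rintro H _ ⟨v, h, hh, rfl⟩
    exact H v h hh

theorem cartierIdeal_mono {J J' : Ideal (MvPolynomial (Fin n) k)} (h : J ≤ J') :
    cartierIdeal p J ≤ cartierIdeal p J' :=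
  cartierIdeal_le_iff.2 fun v _ hg => cartier_mem_cartierIdeal v (h hg)

theorem cartierIdeal_span_pow_mul (g : MvPolynomial (Fin n) k)
    (J : Ideal (MvPolynomial (Fin n) k)) :
    cartierIdeal p (Ideal.span {g ^ p} * J) = Ideal.span {g} * cartierIdeal p J := by
  apply le_antisymm
  · rw [cartierIdeal_le_iff]
    intro v h hh
    obtain ⟨h', hh', rfl⟩ := Ideal.mem_span_singleton_mul.1 hh
    rw [cartier_pow_mul]
    exact Ideal.mul_mem_mul (Ideal.mem_span_singleton_self g) (cartier_mem_cartierIdeal v hh')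
  · rw [Ideal.span_singleton_mul_le_iff]
    intro z hz
    rw [cartierIdeal] at hz
    induction hz using Submodule.span_induction with
    | mem z hz =>
      obtain ⟨v, h, hh, rfl⟩ := hz
      rw [← cartier_pow_mul]
      exact cartier_mem_cartierIdeal v
        (Ideal.mul_mem_mul (Ideal.mem_span_singleton_self _) hh)
    | zero => simp
    | add a b _ _ ha hb =>
      rw [mul_add]
      exact add_mem ha hb
    | smul a b _ hb =>
      rw [smul_eq_mul, mul_left_comm]
      exact Ideal.mul_mem_left _ _ hb

theorem cartierIdeal_span (G : Set (MvPolynomial (Fin n) k)) :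
    cartierIdeal p (Ideal.span G) =
      Ideal.span {g | ∃ v : Fin n → Fin p, ∃ h ∈ G, cartier v h = g} := by
  apply le_antisymm
  · rw [cartierIdeal_le_iff]
    intro v h hh
    induction hh using Submodule.span_induction generalizing v with
    | mem h hh => exact Ideal.subset_span ⟨v, h, hh, rfl⟩
    | zero =>
      rw [show cartier v 0 = 0 from map_zero (cartierHom v)]
      exact zero_mem _
    | add a b _ _ ha hb =>
      rw [cartier_add]
      exact add_mem (ha v) (hb v)
    | smul s g _ hg =>
      -- The ideal element `g` is expanded, not the multiplier `s`: its components `cartier w g` are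
      -- already in the span and come out by `p⁻¹`-linearity.
      rw [smul_eq_mul, ← sum_cartier (p := p) g, Finset.mul_sum, cartier_sum]
      refine Ideal.sum_mem _ fun w _ => ?_
      rw [← mul_assoc, mul_comm, cartier_pow_mul]
      exact Ideal.mul_mem_right _ _ (hg w)
  · refine Ideal.span_mono ?_
    rintro _ ⟨v, h, hh, rfl⟩
    exact ⟨v, h, Ideal.subset_span hh, rfl⟩

theorem cartierIdeal_le_monPow_iff {J : Ideal (MvPolynomial (Fin n) k)} {q : ℕ} :
    cartierIdeal p J ≤ monPow n k q ↔ J ≤ monPow n k (p * q) := by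
  have hp := (Fact.out : p.Prime).pos
  rw [cartierIdeal_le_iff]
  constructor
  · intro H h hh
    rw [mem_monPow_iff]
    intro u hu
    have := mem_monPow_iff.1 (H (expResidue p u) h hh) (expDiv p u) fun i => by
      simpa [expDiv] using Nat.div_lt_of_lt_mul (hu i)
    rwa [coeff_cartier, map_eq_zero_iff _ (RingEquiv.injective _),
      smul_expDiv_add_residueExp] at this
  · intro H v h hh
    rw [mem_monPow_iff]
    intro u hu
    rw [coeff_cartier, map_eq_zero_iff _ (RingEquiv.injective _)]
    refine mem_monPow_iff.1 (H hh) _ fun i => ?_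
    have h1 : p * (u i + 1) ≤ p * q := Nat.mul_le_mul_left p (hu i)
    have h2 := (v i).2
    simp only [residueExp, Finsupp.coe_add, Finsupp.coe_smul, Pi.add_apply, Pi.smul_apply,
      smul_eq_mul, Finsupp.equivFunOnFinite_symm_apply_apply]
    rw [mul_add, mul_one] at h1
    omega

/-- The ideal `(f ^ a)^[1/p^e]`. -/
def levelIdeal (p : ℕ) [Fact p.Prime] [CharP k p] [PerfectRing k p]
    (f : MvPolynomial (Fin n) k) (e a : ℕ) : Ideal (MvPolynomial (Fin n) k) :=
  (cartierIdeal p)^[e] (Ideal.span {f ^ a})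

theorem levelIdeal_succ (f : MvPolynomial (Fin n) k) (e a : ℕ) :
    levelIdeal p f (e + 1) a = cartierIdeal p (levelIdeal p f e a) :=
  Function.iterate_succ_apply' _ _ _

theorem levelIdeal_antitone (f : MvPolynomial (Fin n) k) (e : ℕ) {a b : ℕ} (h : a ≤ b) :
    levelIdeal p f e b ≤ levelIdeal p f e a := by
  induction e with
  | zero => exact Ideal.span_singleton_le_span_singleton.2 (pow_dvd_pow f h)
  | succ e ih =>
    rw [levelIdeal_succ, levelIdeal_succ]
    exact cartierIdeal_mono ih

theorem cartierIdeal_iterate_span_pow_mul (g : MvPolynomial (Fin n) k) (e : ℕ)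
    (J : Ideal (MvPolynomial (Fin n) k)) :
    (cartierIdeal p)^[e] (Ideal.span {g ^ p ^ e} * J) =
      Ideal.span {g} * (cartierIdeal p)^[e] J := by
  induction e generalizing J with
  | zero => simp
  | succ e ih =>
    rw [Function.iterate_succ_apply, pow_succ, pow_mul, cartierIdeal_span_pow_mul, ih,
      Function.iterate_succ_apply]

/-- A Skoda-type periodicity: integer shifts of `a / p^e` only multiply the ideal by a power of `f`.
-/
theorem levelIdeal_add_mul (f : MvPolynomial (Fin n) k) (e a m : ℕ) :
    levelIdeal p f e (a + m * p ^ e) = Ideal.span {f ^ m} * levelIdeal p f e a := by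
  rw [levelIdeal, add_comm, pow_add, pow_mul, ← Ideal.span_singleton_mul_span_singleton,
    cartierIdeal_iterate_span_pow_mul]
  rfl

theorem levelIdeal_le_monPow_iff (f : MvPolynomial (Fin n) k) (e a : ℕ) (q : ℕ) :
    levelIdeal p f e a ≤ monPow n k q ↔ f ^ a ∈ monPow n k (p ^ e * q) := by
  induction e generalizing q with
  | zero => simp [levelIdeal]
  | succ e ih => rw [levelIdeal_succ, cartierIdeal_le_monPow_iff, ih, pow_succ, mul_assoc]

theorem levelIdeal_eq_span (f : MvPolynomial (Fin n) k) (e a : ℕ) :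
    ∃ G : Set (MvPolynomial (Fin n) k), (∀ g ∈ G, g.totalDegree ≤ a * f.totalDegree / p ^ e) ∧
      levelIdeal p f e a = Ideal.span G := by
  induction e with
  | zero =>
    refine ⟨{f ^ a}, fun g hg => ?_, rfl⟩
    rw [Set.mem_singleton_iff.1 hg, pow_zero, Nat.div_one]
    exact totalDegree_pow f a
  | succ e ih =>
    obtain ⟨G, hG, hI⟩ := ih
    refine ⟨_, ?_, by rw [levelIdeal_succ, hI, cartierIdeal_span]⟩
    rintro _ ⟨v, h, hh, rfl⟩
    refine (totalDegree_cartier_le v h).trans ?_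
    rw [pow_succ, ← Nat.div_div_eq_div_mul]
    exact Nat.div_le_div_right (hG h hh)

end Cartier

/-! ### Finiteness of the thresholds of polynomials of bounded degree -/

section Jumps

open MvPolynomial

variable {p : ℕ} [Fact p.Prime] {n : ℕ} {k : Type*} [Field k] [CharP k p] [PerfectRing k p]

/-- A real number in `(0, 1]` across which the ideals `(f ^ a)^[1/p^e]` change. -/
def IsJump (p : ℕ) [Fact p.Prime] [CharP k p] [PerfectRing k p] (f : MvPolynomial (Fin n) k)
    (c : ℝ) : Prop :=
  0 < c ∧ c ≤ 1 ∧ ∀ e a b : ℕ, a / (p : ℝ) ^ e < c → c < b / (p : ℝ) ^ e →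
    levelIdeal p f e a ≠ levelIdeal p f e b

theorem isJump_of_isGLB {f : MvPolynomial (Fin n) k} (hf : eval 0 f = 0) {c : ℝ}
    (hc : IsGLB (polyExpSet p f) c) (hc0 : 0 < c) : IsJump p f c := by
  refine ⟨hc0, hc.1 (one_mem_polyExpSet hf), fun e a b ha hb heq => ?_⟩
  have h1 := pow_notMem_monPow_of_lt hc ha
  have h2 := pow_mem_monPow_of_lt hc hc0.le hb
  -- With `q = 1`, containment in the ideal of the origin separates the two level ideals.
  rw [← mul_one (p ^ e), ← levelIdeal_le_monPow_iff] at h1 h2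
  exact h1 (heq ▸ h2)

/-- The map `c ↦ p c - ⌈p c⌉ + 1` of `(0, 1]` to itself. -/
def mulFract (p : ℕ) (c : ℝ) : ℝ := p * c - (⌈p * c⌉ - 1)

/-- An equality of level ideals around `p c - m` persists after multiplying by `f ^ m` and applying
the Cartier operators once more, which gives an equality around `c` at level `e + 1`. -/
theorem isJump_mulFract {f : MvPolynomial (Fin n) k} {c : ℝ} (hc : IsJump p f c) :
    IsJump p f (mulFract p c) := by
  have hp : (0 : ℝ) < p := by exact_mod_cast (Fact.out : p.Prime).pos
  have hpc : 0 < p * c := mul_pos hp hc.1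
  have h1 := Int.ceil_lt_add_one ((p : ℝ) * c)
  have h2 := Int.le_ceil ((p : ℝ) * c)
  obtain ⟨m, hm⟩ : ∃ m : ℕ, (⌈(p : ℝ) * c⌉ : ℤ) - 1 = m := by
    refine ⟨(⌈(p : ℝ) * c⌉ - 1).toNat, (Int.toNat_of_nonneg ?_).symm⟩
    have := Int.ceil_pos.2 hpc
    omega
  have hm' : (⌈(p : ℝ) * c⌉ : ℝ) - 1 = m := by exact_mod_cast hm
  have key : mulFract p c = p * c - m := by rw [mulFract, hm']
  refine ⟨by rw [key]; linarith, by rw [key]; linarith, fun e a b ha hb heq => ?_⟩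
  rw [key] at ha hb
  have hpe : (0 : ℝ) < (p : ℝ) ^ e := by positivity
  refine hc.2.2 (e + 1) (a + m * p ^ e) (b + m * p ^ e) ?_ ?_ ?_
  · rw [div_lt_iff₀ (by positivity)]
    rw [div_lt_iff₀ hpe] at ha
    push_cast
    rw [pow_succ]
    linarith
  · rw [lt_div_iff₀ (by positivity)]
    rw [lt_div_iff₀ hpe] at hb
    push_cast
    rw [pow_succ]
    linarith
  · rw [levelIdeal_succ, levelIdeal_succ, levelIdeal_add_mul, levelIdeal_add_mul, heq]

theorem isJump_iterate {f : MvPolynomial (Fin n) k} {c : ℝ} (hc : IsJump p f c) (i : ℕ) :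
    IsJump p f ((mulFract p)^[i] c) := by
  induction i with
  | zero => exact hc
  | succ i ih =>
    rw [Function.iterate_succ_apply']
    exact isJump_mulFract ih

omit [Fact p.Prime] in
theorem exists_iterate_mulFract (c : ℝ) (i : ℕ) :
    ∃ z : ℤ, (mulFract p)^[i] c = (p : ℝ) ^ i * c - z := by
  induction i with
  | zero => exact ⟨0, by simp⟩
  | succ i ih =>
    obtain ⟨z, hz⟩ := ih
    refine ⟨p * z + (⌈p * (mulFract p)^[i] c⌉ - 1), ?_⟩
    rw [Function.iterate_succ_apply']
    conv_lhs => rw [mulFract]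
    push_cast
    rw [pow_succ, hz]
    ring

/-- The exponent vectors of degree at most `D`. -/
def boundedExps (n D : ℕ) : Set (Fin n →₀ ℕ) := {u | (u.sum fun _ e => e) ≤ D}

theorem finite_boundedExps (n D : ℕ) : (boundedExps n D).Finite := by
  refine Set.Finite.subset (Finsupp.finite_of_degree_le D) fun u hu => ?_
  exact hu

theorem finrank_restrictTotalDegree (k : Type*) [Field k] (D : ℕ) :
    Module.Finite k (restrictTotalDegree (Fin n) k D) ∧
    Module.finrank k (restrictTotalDegree (Fin n) k D) = Nat.card (boundedExps n D) := by
  have := (finite_boundedExps n D).to_subtype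
  have b : Module.Basis (boundedExps n D) k (restrictTotalDegree (Fin n) k D) :=
    basisRestrictSupport k (boundedExps n D)
  exact ⟨Module.Finite.of_basis b, Module.finrank_eq_nat_card_basis b⟩

/-- The part of degree at most `D` of `levelIdeal`. -/
def levelSpace (p : ℕ) [Fact p.Prime] [CharP k p] [PerfectRing k p]
    (f : MvPolynomial (Fin n) k) (D e a : ℕ) : Submodule k (restrictTotalDegree (Fin n) k D) :=
  ((levelIdeal p f e a).restrictScalars k).comap (Submodule.subtype _)

theorem levelIdeal_le_of_levelSpace_le {f : MvPolynomial (Fin n) k} {D e a b : ℕ}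
    (hD : f.totalDegree ≤ D) (ha : a ≤ p ^ e) (h : levelSpace p f D e a ≤ levelSpace p f D e b) :
    levelIdeal p f e a ≤ levelIdeal p f e b := by
  obtain ⟨G, hG, hI⟩ := levelIdeal_eq_span (p := p) f e a
  conv_lhs => rw [hI]
  rw [Ideal.span_le]
  intro g hg
  have hgD : g ∈ restrictTotalDegree (Fin n) k D := by
    rw [mem_restrictTotalDegree]
    refine (hG g hg).trans (le_trans (Nat.div_le_of_le_mul ?_) hD)
    exact Nat.mul_le_mul_right _ ha
  have : (⟨g, hgD⟩ : restrictTotalDegree (Fin n) k D) ∈ levelSpace p f D e a := by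
    show g ∈ levelIdeal p f e a
    rw [hI]
    exact Ideal.subset_span hg
  exact h this

theorem card_le_of_isJump {f : MvPolynomial (Fin n) k} {D : ℕ} (hD : f.totalDegree ≤ D)
    (T : Finset ℝ) (hT : ∀ c ∈ T, IsJump p f c) : T.card ≤ Nat.card (boundedExps n D) + 1 := by
  have hp : 1 < (p : ℝ) := by exact_mod_cast (Fact.out : p.Prime).one_lt
  obtain ⟨hfin, hrank⟩ := finrank_restrictTotalDegree (n := n) k D
  have htend : Filter.Tendsto (fun e : ℕ => 3 / (p : ℝ) ^ e) Filter.atTop (nhds 0) :=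
    Filter.Tendsto.div_atTop tendsto_const_nhds (tendsto_pow_atTop_atTop_of_one_lt hp)
  -- With `a c` the largest integer below `c p^e`, one has `c p^e < a c + 2`; gaps above `3 / p^e`
  -- then force `a c + 2 ≤ a d` for `c < d`.
  have hev : ∀ᶠ e : ℕ in Filter.atTop, ∀ c ∈ T, ∀ d ∈ T, c < d → 3 / (p : ℝ) ^ e < d - c := by
    rw [Filter.eventually_all_finset]
    intro c _
    rw [Filter.eventually_all_finset]
    intro d _
    by_cases hcd : c < d
    · filter_upwards [htend.eventually (gt_mem_nhds (sub_pos.2 hcd))] with e he _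
      exact he
    · exact Filter.Eventually.of_forall fun _ h => absurd h hcd
  obtain ⟨e, he⟩ := hev.exists
  have hpe : (0 : ℝ) < (p : ℝ) ^ e := by positivity
  let a : ℝ → ℕ := fun c => ⌈c * (p : ℝ) ^ e⌉₊ - 1
  have ha : ∀ c ∈ T, (a c : ℝ) = ⌈c * (p : ℝ) ^ e⌉₊ - 1 := by
    intro c hc
    have : 0 < ⌈c * (p : ℝ) ^ e⌉₊ := Nat.ceil_pos.2 (mul_pos (hT c hc).1 hpe)
    simp only [a]
    rw [Nat.cast_sub (by omega)]
    simp
  have ha1 : ∀ c ∈ T, (a c : ℝ) / (p : ℝ) ^ e < c := by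
    intro c hc
    rw [div_lt_iff₀ hpe, ha c hc]
    have := Nat.ceil_lt_add_one (mul_pos (hT c hc).1 hpe).le
    linarith
  have ha2 : ∀ c ∈ T, c < ((a c + 2 : ℕ) : ℝ) / (p : ℝ) ^ e := by
    intro c hc
    rw [lt_div_iff₀ hpe]
    push_cast
    rw [ha c hc]
    have := Nat.le_ceil (c * (p : ℝ) ^ e)
    linarith
  have ha3 : ∀ c ∈ T, ∀ d ∈ T, c < d → a c + 2 ≤ a d := by
    intro c hc d hd hcd
    have h1 := he c hc d hd hcd
    rw [div_lt_iff₀ hpe] at h1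
    have h2 := ha1 c hc
    rw [div_lt_iff₀ hpe] at h2
    have h3 := ha2 d hd
    rw [lt_div_iff₀ hpe] at h3
    push_cast at h3
    have : (a c : ℝ) + 1 < a d := by linarith
    have : a c + 1 < a d := by exact_mod_cast this
    omega
  have hle : ∀ c ∈ T, a c ≤ p ^ e := by
    intro c hc
    have h2 := ha1 c hc
    rw [div_lt_iff₀ hpe] at h2
    have : (a c : ℝ) < (p : ℝ) ^ e := by
      refine h2.trans_le ?_
      have := (hT c hc).2.1
      nlinarith
    exact_mod_cast this.le
  have hlt : ∀ c ∈ T, ∀ d ∈ T, c < d → levelSpace p f D e (a d) < levelSpace p f D e (a c) := by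
    intro c hc d hd hcd
    have h1 : levelIdeal p f e (a d) ≤ levelIdeal p f e (a c + 2) :=
      levelIdeal_antitone f e (ha3 c hc d hd hcd)
    refine lt_of_le_not_ge (fun x hx => ?_) fun hcon => ?_
    · exact h1.trans (levelIdeal_antitone f e (by omega)) hx
    · have h2 := levelIdeal_le_of_levelSpace_le hD (hle c hc) hcon
      exact (hT c hc).2.2 e _ _ (ha1 c hc) (ha2 c hc)
        (le_antisymm (h2.trans h1) (levelIdeal_antitone f e (by omega)))
  -- These dimensions strictly decrease along `T`, and they range from `0` to the dimension of the
  -- ambient space.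
  let r : ℝ → ℕ := fun c => Module.finrank k (levelSpace p f D e (a c))
  have hr : ∀ c ∈ T, ∀ d ∈ T, c < d → r d < r c := fun c hc d hd hcd =>
    Submodule.finrank_lt_finrank_of_lt (hlt c hc d hd hcd)
  rw [← Finset.card_range (Nat.card (boundedExps n D) + 1)]
  refine Finset.card_le_card_of_injOn r (fun c _ => ?_) fun c hc d hd hcd => ?_
  · rw [Finset.coe_range, Set.mem_Iio, Nat.lt_succ_iff, ← hrank]
    exact Submodule.finrank_le _
  · rcases lt_trichotomy c d with h | h | h
    · exact absurd hcd (hr c hc d hd h).ne'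
    · exact h
    · exact absurd hcd (hr d hd c hc h).ne

/-- A finite set containing the thresholds of all polynomials of degree at most `D`. -/
def thresholdCandidates (p n D : ℕ) : Set ℝ :=
  {c | ∃ i j z : ℕ, i < j ∧ j ≤ Nat.card (boundedExps n D) + 1 ∧ z ≤ p ^ j ∧
    c = z / ((p : ℝ) ^ j - (p : ℝ) ^ i)}

theorem finite_thresholdCandidates (p n D : ℕ) : (thresholdCandidates p n D).Finite := by
  let B := Nat.card (boundedExps n D) + 1
  refine Set.Finite.subset (s := (fun x : (ℕ × ℕ) × ℕ =>
    (x.2 : ℝ) / ((p : ℝ) ^ x.1.2 - (p : ℝ) ^ x.1.1)) ''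
      ⋃ j ∈ Set.Iic B, ((Set.Iio j ×ˢ {j}) ×ˢ Set.Iic (p ^ j))) ?_ ?_
  · refine Set.Finite.image _ (Set.Finite.biUnion (Set.finite_Iic B) fun j _ => ?_)
    exact ((Set.finite_Iio j).prod (Set.finite_singleton j)).prod (Set.finite_Iic _)
  · rintro _ ⟨i, j, z, hij, hj, hz, rfl⟩
    refine ⟨((i, j), z), ?_, rfl⟩
    simp only [Set.mem_iUnion]
    exact ⟨j, hj, ⟨hij, rfl⟩, hz⟩

theorem IsJump.mem_thresholdCandidates {f : MvPolynomial (Fin n) k} {c : ℝ} (hc : IsJump p f c)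
    {D : ℕ} (hD : f.totalDegree ≤ D) : c ∈ thresholdCandidates p n D := by
  classical
  have hp : 1 < (p : ℝ) := by exact_mod_cast (Fact.out : p.Prime).one_lt
  let B := Nat.card (boundedExps n D) + 1
  -- Pigeonhole: the iterates with indices `0, …, B` are all jumps, and there are at most `B` jumps.
  obtain ⟨i, hi, j, hj, hne, hij⟩ : ∃ i ∈ Finset.range (B + 1), ∃ j ∈ Finset.range (B + 1),
      i ≠ j ∧ (mulFract p)^[i] c = (mulFract p)^[j] c := by
    refine Finset.exists_ne_map_eq_of_card_lt_of_maps_to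
      (t := (Finset.range (B + 1)).image fun i => (mulFract p)^[i] c) ?_ fun i hi =>
        Finset.mem_image_of_mem _ hi
    rw [Finset.card_range, Nat.lt_succ_iff]
    refine card_le_of_isJump hD _ fun d hd => ?_
    obtain ⟨i, -, rfl⟩ := Finset.mem_image.1 hd
    exact isJump_iterate hc i
  wlog hlt : i < j generalizing i j
  · exact this j hj i hi hne.symm hij.symm (by omega)
  obtain ⟨y, hy⟩ := exists_iterate_mulFract (p := p) c i
  obtain ⟨z, hz⟩ := exists_iterate_mulFract (p := p) c j
  have hpos : (0 : ℝ) < (p : ℝ) ^ j - (p : ℝ) ^ i := sub_pos.2 (pow_lt_pow_right₀ hp hlt)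
  have heq : c * ((p : ℝ) ^ j - (p : ℝ) ^ i) = ((z - y : ℤ) : ℝ) := by
    push_cast
    rw [hy, hz] at hij
    linarith
  have hnn : 0 ≤ z - y := by
    have : (0 : ℝ) ≤ ((z - y : ℤ) : ℝ) := by
      rw [← heq]
      exact mul_nonneg hc.1.le hpos.le
    exact_mod_cast this
  obtain ⟨w, hw⟩ := Int.eq_ofNat_of_zero_le hnn
  rw [hw, Int.cast_natCast] at heq
  refine ⟨i, j, w, hlt, Nat.lt_succ_iff.1 (Finset.mem_range.1 hj), ?_, ?_⟩
  · have : (w : ℝ) ≤ (p : ℝ) ^ j := by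
      rw [← heq]
      have h1 := hc.2.1
      have h2 : (0 : ℝ) < (p : ℝ) ^ i := by positivity
      nlinarith
    exact_mod_cast this
  · rw [eq_div_iff hpos.ne', heq]

end Jumps

/-! ### Independence of the algebraically closed field -/

section Independence

open MvPolynomial

variable {p : ℕ} [Fact p.Prime] {n : ℕ}

theorem mem_thresholdCandidates_or_eq_zero {k : Type*} [Field k] [CharP k p] [PerfectRing k p]
    {f : MvPolynomial (Fin n) k} (hf : eval 0 f = 0) {D : ℕ} (hD : f.totalDegree ≤ D) {c : ℝ}
    (hc : IsGLB (polyExpSet p f) c) : c ∈ thresholdCandidates p n D ∪ {0} := by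
  rcases (nonneg_of_isGLB_polyExpSet hc).eq_or_lt with h | h
  · exact Or.inr h.symm
  · exact Or.inl ((isJump_of_isGLB hf hc h).mem_thresholdCandidates hD)

theorem polyThresholds_subset_of_isAlgClosed (k K : Type*) [Field k] [CharP k p] [IsAlgClosed k]
    [Field K] [CharP K p] [IsAlgClosed K] : polyThresholds p n K ⊆ polyThresholds p n k := by
  intro c hc
  rw [mem_polyThresholds_iff] at hc
  obtain ⟨f, hf, hc⟩ := hc
  change IsGLB (polyExpSet p f) c at hc
  rcases (nonneg_of_isGLB_polyExpSet hc).eq_or_lt with rfl | hc0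
  · exact zero_mem_polyThresholds
  have hp : 1 < (p : ℝ) := by exact_mod_cast (Fact.out : p.Prime).one_lt
  set D := f.totalDegree with hD
  have hfin : (thresholdCandidates p n D ∪ {0}).Finite :=
    (finite_thresholdCandidates p n D).union (Set.finite_singleton 0)
  have htend : Filter.Tendsto (fun e : ℕ => 2 / (p : ℝ) ^ e) Filter.atTop (nhds 0) :=
    Filter.Tendsto.div_atTop tendsto_const_nhds (tendsto_pow_atTop_atTop_of_one_lt hp)
  -- The candidate set depends only on `p`, `n` and `D`, so `e` can be fixed before specializing;
  -- specialization does not raise the degree.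
  have hev : ∀ᶠ e : ℕ in Filter.atTop, ∀ d ∈ thresholdCandidates p n D ∪ {0}, d ≠ c →
      2 / (p : ℝ) ^ e < |d - c| := by
    rw [Filter.eventually_all_finite hfin]
    intro d _
    by_cases hcd : d = c
    · exact Filter.Eventually.of_forall fun _ h => absurd hcd h
    · filter_upwards [htend.eventually (gt_mem_nhds (abs_pos.2 (sub_ne_zero.2 hcd)))] with e he _
      exact he
  obtain ⟨e, he⟩ := hev.exists
  have hpe : (0 : ℝ) < (p : ℝ) ^ e := by positivity
  obtain ⟨a, ha⟩ : ∃ a, ⌈c * (p : ℝ) ^ e⌉₊ = a + 1 :=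
    Nat.exists_eq_succ_of_ne_zero (Nat.ceil_pos.2 (mul_pos hc0 hpe)).ne'
  have ha' : (⌈c * (p : ℝ) ^ e⌉₊ : ℝ) = a + 1 := by exact_mod_cast ha
  have h1 : a / (p : ℝ) ^ e < c := by
    rw [div_lt_iff₀ hpe]
    have := Nat.ceil_lt_add_one (mul_pos hc0 hpe).le
    linarith
  have h2 : c < ((a + 2 : ℕ) : ℝ) / (p : ℝ) ^ e := by
    rw [lt_div_iff₀ hpe]
    push_cast
    have := Nat.le_ceil (c * (p : ℝ) ^ e)
    linarith
  obtain ⟨f', hdeg, hf'a, hf'⟩ := exists_specialization k f (pow_notMem_monPow_of_lt hc h1)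
  have hf'b := hf' _ _ (pow_mem_monPow_of_lt hc hc0.le h2)
  have hf'0 : eval 0 f' = 0 :=
    eval_zero_eq_zero_of_pow_mem (pow_pos (Fact.out : p.Prime).pos e) hf'b
  obtain ⟨c', hc'⟩ := exists_isGLB_polyExpSet (p := p) hf'0
  have h3 : a / (p : ℝ) ^ e ≤ c' := by
    by_contra hlt
    exact hf'a (pow_mem_monPow_of_lt hc' (nonneg_of_isGLB_polyExpSet hc') (not_le.1 hlt))
  have h4 := le_div_of_pow_mem hc' (by omega) hf'b
  have hcc : c' = c := by
    by_contra hne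
    have h5 := he c' (mem_thresholdCandidates_or_eq_zero hf'0 hdeg hc') hne
    refine absurd h5 (not_lt.2 (abs_le.2 ?_))
    push_cast at h2 h4
    rw [add_div] at h2 h4
    constructor <;> linarith
  rw [mem_polyThresholds_iff]
  exact ⟨f', hf'0, hcc ▸ hc'⟩

end Independence

/-! ### Regular systems of parameters -/

section RegularSystem

open IsLocalRing

theorem ringKrullDim_le_card {S : Type*} [CommRing S] [IsLocalRing S] [IsNoetherianRing S]
    {s : Finset S} (hs : Ideal.span (s : Set S) = maximalIdeal S) :
    ringKrullDim S ≤ (s.card : ℕ) := by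
  refine (ringKrullDim_le_spanFinrank_maximalIdeal S).trans ?_
  rw [← hs]
  have := Submodule.spanFinrank_span_le_ncard_of_finite (R := S) s.finite_toSet
  rw [Set.ncard_coe_finset] at this
  exact_mod_cast this

theorem le_ringKrullDim_quotient {S : Type*} [CommRing S] [IsLocalRing S] [IsNoetherianRing S]
    {T : Finset S} (hT : ∀ x ∈ T, x ∈ maximalIdeal S) {d : ℕ}
    (hd : ((d + T.card : ℕ) : WithBot ℕ∞) ≤ ringKrullDim S) :
    (d : WithBot ℕ∞) ≤ ringKrullDim (S ⧸ Ideal.span (T : Set S)) := by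
  have := hd.trans (ringKrullDim_le_ringKrullDim_quotient_add_card T fun x hx => by
    rw [← Ideal.jacobson_bot, IsLocalRing.jacobson_eq_maximalIdeal _ bot_ne_top]
    exact hT x hx)
  exact ENat.WithBot.add_le_add_natCast_right_iff.1 (by exact_mod_cast this)

theorem isLocalRing_quotient {S : Type*} [CommRing S] [IsLocalRing S] {I : Ideal S}
    (hI : I ≤ maximalIdeal S) : IsLocalRing (S ⧸ I) := by
  have : Nontrivial (S ⧸ I) :=
    Ideal.Quotient.nontrivial_iff.2 fun h => Ideal.IsPrime.ne_top' (top_le_iff.1 (h ▸ hI))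
  exact .of_surjective' (Ideal.Quotient.mk I) Ideal.Quotient.mk_surjective

/-- If `T ∪ U` generates the maximal ideal, then the image of `U` generates the maximal ideal
of the quotient by `T`. -/
theorem span_image_mk_eq_maximalIdeal {S : Type*} [CommRing S] [IsLocalRing S]
    [DecidableEq S] {T U : Finset S} [IsLocalRing (S ⧸ Ideal.span (T : Set S))]
    [DecidableEq (S ⧸ Ideal.span (T : Set S))]
    (h : Ideal.span ((T ∪ U : Finset S) : Set S) = maximalIdeal S) :
    Ideal.span ((U.image (Ideal.Quotient.mk (Ideal.span (T : Set S))) : Finset _) :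
      Set (S ⧸ Ideal.span (T : Set S))) = maximalIdeal _ := by
  rw [← map_maximalIdeal_of_surjective (Ideal.Quotient.mk (Ideal.span (T : Set S)))
    Ideal.Quotient.mk_surjective, ← h, Finset.coe_union, Ideal.span_union, Ideal.map_sup,
    Ideal.map_quotient_self, bot_sup_eq, Ideal.map_span, Finset.coe_image]

/-- A Noetherian local ring whose maximal ideal is generated by at most `dim` elements is a
domain. -/
theorem isDomain_of_card_le_ringKrullDim (d : ℕ) {S : Type*} [CommRing S] [IsLocalRing S]
    [IsNoetherianRing S] (s : Finset S) (hs : Ideal.span (s : Set S) = maximalIdeal S)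
    (hsd : s.card ≤ d) (hd : (d : WithBot ℕ∞) ≤ ringKrullDim S) : IsDomain S := by
  classical
  induction d generalizing S with
  | zero =>
    have : s = ∅ := Finset.card_eq_zero.1 (Nat.le_zero.1 hsd)
    rw [this, Finset.coe_empty, Ideal.span_empty] at hs
    exact (isField_iff_maximalIdeal_eq.2 hs.symm).isDomain
  | succ d ih =>
    have hdim : (1 : WithBot ℕ∞) ≤ ringKrullDim S := by
      refine le_trans ?_ hd
      exact_mod_cast Nat.le_add_left 1 d
    have hmin : ∀ P ∈ minimalPrimes S, ¬ maximalIdeal S ≤ P := by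
      intro P hP hle
      have hPp : P.IsPrime := hP.1.1
      have hPm : P = maximalIdeal S := le_antisymm (le_maximalIdeal hPp.ne_top) hle
      rw [hPm] at hP
      rw [← maximalIdeal_height_eq_ringKrullDim, Ideal.height_eq_zero_iff.2 hP] at hdim
      exact absurd hdim (by simp)
    have hsq : ¬ maximalIdeal S ≤ maximalIdeal S ^ 2 := by
      intro hle
      have hbot : maximalIdeal S = ⊥ := by
        refine Submodule.eq_bot_of_le_smul_of_le_jacobson_bot (maximalIdeal S) _
          (maximalIdeal S).fg_of_isNoetherianRing (by rwa [smul_eq_mul, ← sq]) ?_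
        rw [IsLocalRing.jacobson_eq_maximalIdeal _ bot_ne_top]
      have hcard := ringKrullDim_le_card (S := S) (s := ∅) (by simp [hbot])
      exact absurd (hdim.trans hcard) (by simp)
    -- Prime avoidance, which tolerates the non-prime ideal `m ^ 2` among the ideals to be avoided.
    obtain ⟨x, hxm, hx⟩ : ∃ x ∈ maximalIdeal S, x ∉ maximalIdeal S ^ 2 ∧
        ∀ P ∈ minimalPrimes S, x ∉ P := by
      by_contra hcon
      push Not at hcon
      let F := insert (maximalIdeal S ^ 2) (minimalPrimes.finite_of_isNoetherianRing S).toFinset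
      have := (Ideal.subset_union_prime (s := F) (f := id) (maximalIdeal S ^ 2)
        (maximalIdeal S ^ 2) (fun P hP hne _ => ?_) (I := maximalIdeal S)).1 ?_
      · obtain ⟨P, hP, hle⟩ := this
        rcases Finset.mem_insert.1 hP with rfl | hP
        · exact hsq hle
        · exact hmin P ((Set.Finite.mem_toFinset _).1 hP) hle
      · rcases Finset.mem_insert.1 hP with rfl | hP
        · exact absurd rfl hne
        · exact ((Set.Finite.mem_toFinset _).1 hP).1.1
      · intro x hx
        simp only [Set.mem_iUnion]
        by_cases hx2 : x ∈ maximalIdeal S ^ 2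
        · exact ⟨_, Finset.mem_insert_self _ _, hx2⟩
        · obtain ⟨P, hP, hxP⟩ := hcon x hx hx2
          exact ⟨P, Finset.mem_insert_of_mem ((Set.Finite.mem_toFinset _).2 hP), hxP⟩
    obtain ⟨hx2, hxP⟩ := hx
    obtain ⟨a, -, hax⟩ := Submodule.mem_span_finset.1 (hs.symm ▸ hxm : x ∈ Ideal.span (s : Set S))
    -- Since `x ∉ m ^ 2`, some coefficient of `x` in the generators is a unit, so `x` can be
    -- exchanged for a generator `y`.
    obtain ⟨y, hys, hy⟩ : ∃ y ∈ s, IsUnit (a y) := by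
      by_contra hcon
      push Not at hcon
      refine hx2 ?_
      rw [← hax, sq]
      exact Ideal.sum_mem _ fun y hy => Ideal.mul_mem_mul ((mem_maximalIdeal _).2 (hcon y hy))
        (hs ▸ Ideal.subset_span hy)
    have hspan : Ideal.span ((({x} : Finset S) ∪ s.erase y : Finset S) : Set S) =
        maximalIdeal S := by
      apply le_antisymm
      · rw [Ideal.span_le]
        intro z hz
        rw [Finset.mem_coe, Finset.mem_union, Finset.mem_singleton] at hz
        rcases hz with rfl | hz
        · exact hxm
        · exact hs ▸ Ideal.subset_span (Finset.mem_of_mem_erase hz)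
      · rw [← hs, Ideal.span_le]
        intro z hz
        have hmem : ∀ w ∈ s.erase y,
            w ∈ Ideal.span ((({x} : Finset S) ∪ s.erase y : Finset S) : Set S) := fun w hw =>
          Ideal.subset_span (Finset.mem_coe.2 (Finset.mem_union_right _ hw))
        by_cases hzy : z = y
        · subst hzy
          rw [← Finset.add_sum_erase s _ hys, smul_eq_mul] at hax
          rw [SetLike.mem_coe, ← Ideal.unit_mul_mem_iff_mem _ hy, eq_sub_of_add_eq hax]
          refine sub_mem (Ideal.subset_span (by simp)) (Ideal.sum_mem _ fun w hw => ?_)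
          exact Ideal.mul_mem_left _ _ (hmem w hw)
        · exact hmem z (Finset.mem_erase.2 ⟨hzy, hz⟩)
    have hxle : Ideal.span (({x} : Finset S) : Set S) ≤ maximalIdeal S := by
      rw [Finset.coe_singleton, Ideal.span_singleton_le_iff_mem]
      exact hxm
    have hloc := isLocalRing_quotient hxle
    have hdom : IsDomain (S ⧸ Ideal.span (({x} : Finset S) : Set S)) := by
      refine ih _ (span_image_mk_eq_maximalIdeal hspan) ?_
        (le_ringKrullDim_quotient (fun z hz => by rwa [Finset.mem_singleton.1 hz])
          (by rwa [Finset.card_singleton]))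
      refine Finset.card_image_le.trans ?_
      rw [Finset.card_erase_of_mem hys]
      omega
    have hprime : (Ideal.span ({x} : Set S)).IsPrime := by
      rw [← Ideal.Quotient.isDomain_iff_prime]
      rwa [Finset.coe_singleton] at hdom
    obtain ⟨P, hP, hPx⟩ := Ideal.exists_minimalPrimes_le (I := ⊥)
      (J := Ideal.span ({x} : Set S)) bot_le
    have hPp : P.IsPrime := hP.1.1
    -- A minimal prime inside `(x)` that does not contain `x` satisfies `P = x P`; Nakayama then
    -- gives `P = 0`.
    have hPbot : P = ⊥ := by
      refine Submodule.eq_bot_of_le_smul_of_le_jacobson_bot (Ideal.span {x}) _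
        P.fg_of_isNoetherianRing ?_ ?_
      · intro y hy
        obtain ⟨z, rfl⟩ := Ideal.mem_span_singleton.1 (hPx hy)
        have hz := (hPp.mem_or_mem hy).resolve_left (hxP P hP)
        exact Submodule.smul_mem_smul (Ideal.mem_span_singleton_self x) hz
      · rw [IsLocalRing.jacobson_eq_maximalIdeal _ bot_ne_top]
        rwa [Finset.coe_singleton] at hxle
    have : (⊥ : Ideal S).IsPrime := hPbot ▸ hPp
    exact IsDomain.of_bot_isPrime S

/-- A finite set all of whose subsets generate prime ideals not containing the other elements. -/
def IsPrimeSystem {S : Type*} [CommRing S] (s : Finset S) : Prop :=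
  ∀ T ⊆ s, (Ideal.span (T : Set S)).IsPrime ∧ ∀ x ∈ s, x ∉ T → x ∉ Ideal.span (T : Set S)

/-- Take minimal generators of the maximal ideal. Modulo a subset `T` the dimension drops by at most
`T.card`, so the remaining generators make the quotient a domain; a redundant generator would
contradict the dimension. -/
theorem exists_isPrimeSystem (S : Type*) [CommRing S] [hS : IsRegularLocalRing S] :
    ∃ s : Finset S, Ideal.span (s : Set S) = maximalIdeal S ∧
      (s.card : WithBot ℕ∞) = ringKrullDim S ∧ IsPrimeSystem s := by
  classical
  have hfg := (maximalIdeal S).fg_of_isNoetherianRing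
  let s := (Submodule.FG.finite_generators hfg).toFinset
  have hs : Ideal.span (s : Set S) = maximalIdeal S := by
    rw [Set.Finite.coe_toFinset]
    exact (maximalIdeal S).span_generators
  have hcard : (s.card : WithBot ℕ∞) = ringKrullDim S := by
    rw [← hS.spanFinrank_maximalIdeal, ← Submodule.FG.generators_ncard hfg,
      Set.ncard_eq_toFinset_card _ (Submodule.FG.finite_generators hfg)]
  refine ⟨s, hs, hcard, fun T hT => ⟨?_, fun x hx hxT hxm => ?_⟩⟩
  · have hTm : ∀ x ∈ T, x ∈ maximalIdeal S := fun x hx => hs ▸ Ideal.subset_span (hT hx)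
    have hloc := isLocalRing_quotient (Ideal.span_le.2 hTm)
    rw [← Ideal.Quotient.isDomain_iff_prime]
    refine isDomain_of_card_le_ringKrullDim (s.card - T.card)
      ((s \ T).image (Ideal.Quotient.mk (Ideal.span (T : Set S))))
      (span_image_mk_eq_maximalIdeal (by rwa [Finset.union_sdiff_of_subset hT]))
      (Finset.card_image_le.trans (Finset.card_sdiff_of_subset hT).le)
      (le_ringKrullDim_quotient hTm ?_)
    rw [Nat.sub_add_cancel (Finset.card_le_card hT), hcard]
  · have hs' : Ideal.span ((s.erase x : Finset S) : Set S) = maximalIdeal S := by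
      rw [← hs]
      refine le_antisymm (Ideal.span_mono (Finset.coe_subset.2 (Finset.erase_subset _ _))) ?_
      rw [Ideal.span_le]
      intro z hz
      by_cases hzx : z = x
      · rw [hzx]
        refine Ideal.span_mono ?_ hxm
        intro w hw
        exact Finset.mem_coe.2 (Finset.mem_erase.2 ⟨fun h => hxT (h ▸ hw), hT hw⟩)
      · exact Ideal.subset_span (Finset.mem_coe.2 (Finset.mem_erase.2 ⟨hzx, hz⟩))
    have h1 := ringKrullDim_le_card hs'
    rw [← hcard, Finset.card_erase_of_mem hx] at h1
    have h2 : s.card ≤ s.card - 1 := by exact_mod_cast h1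
    have := Finset.card_pos.2 ⟨x, hx⟩
    omega

/-- Induction on `q`: write `z = w' + y^q t'` and cancel `y^q` modulo `I`. This leaves `x t' ∈ I +
(y)`, so `t'` supplies the missing factor `y`. -/
theorem mem_sup_span_pow_of_mul_mem {S : Type*} [CommRing S] {I : Ideal S} {x y : S}
    (hy : ∀ z, y * z ∈ I → z ∈ I)
    (hx : ∀ z, x * z ∈ I ⊔ Ideal.span {y} → z ∈ I ⊔ Ideal.span {y}) (q : ℕ) {z : S}
    (hz : x * z ∈ I ⊔ Ideal.span {y ^ q}) : z ∈ I ⊔ Ideal.span {y ^ q} := by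
  have hyq : ∀ q z, y ^ q * z ∈ I → z ∈ I := by
    intro q
    induction q with
    | zero => simp
    | succ q ih =>
      intro z hz
      rw [pow_succ, mul_assoc] at hz
      exact hy z (ih _ hz)
  induction q generalizing z with
  | zero => simp
  | succ q ih =>
    have hle : I ⊔ Ideal.span {y ^ (q + 1)} ≤ I ⊔ Ideal.span {y ^ q} :=
      sup_le_sup_left (Ideal.span_singleton_le_span_singleton.2 (pow_dvd_pow y q.le_succ)) _
    obtain ⟨w', hw', t', ht', rfl⟩ := Submodule.mem_sup.1 (ih (hle hz))
    obtain ⟨t', rfl⟩ := Ideal.mem_span_singleton.1 ht'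
    obtain ⟨w, hw, t, ht, hzt⟩ := Submodule.mem_sup.1 hz
    obtain ⟨t, rfl⟩ := Ideal.mem_span_singleton.1 ht
    have h1 : y ^ q * (x * t' - y * t) ∈ I := by
      have : y ^ q * (x * t' - y * t) = w - x * w' := by
        rw [pow_succ] at hzt
        linear_combination -hzt
      rw [this]
      exact sub_mem hw (Ideal.mul_mem_left _ _ hw')
    have h2 : t' ∈ I ⊔ Ideal.span {y} := by
      refine hx t' ?_
      rw [← sub_add_cancel (x * t') (y * t)]
      exact add_mem (Ideal.mem_sup_left (hyq q _ h1))
        (Ideal.mem_sup_right (Ideal.mul_mem_right _ _ (Ideal.mem_span_singleton_self y)))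
    obtain ⟨w'', hw'', t'', ht'', rfl⟩ := Submodule.mem_sup.1 h2
    obtain ⟨t'', rfl⟩ := Ideal.mem_span_singleton.1 ht''
    rw [mul_add, ← add_assoc]
    refine add_mem (Ideal.mem_sup_left (add_mem hw' (Ideal.mul_mem_left _ _ hw'')))
      (Ideal.mem_sup_right ?_)
    rw [← mul_assoc, ← pow_succ]
    exact Ideal.mul_mem_right _ _ (Ideal.mem_span_singleton_self _)

variable {S : Type*} [CommRing S]

/-- The ideal generated by the elements of `A` and the `q`-th powers of the elements of `T`. -/
def mixedIdeal (q : ℕ) (A T : Finset S) : Ideal S :=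
  Ideal.span (A : Set S) ⊔ Ideal.span ((fun x => x ^ q) '' (T : Set S))

theorem mixedIdeal_insert_right [DecidableEq S] (q : ℕ) (A T : Finset S) (x : S) :
    mixedIdeal q A (insert x T) = mixedIdeal q A T ⊔ Ideal.span {x ^ q} := by
  rw [mixedIdeal, mixedIdeal, Finset.coe_insert, Set.image_insert_eq, Ideal.span_insert,
    sup_assoc, sup_comm (Ideal.span {x ^ q})]

theorem mixedIdeal_insert_left [DecidableEq S] (q : ℕ) (A T : Finset S) (x : S) :
    mixedIdeal q (insert x A) T = mixedIdeal q A T ⊔ Ideal.span {x} := by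
  rw [mixedIdeal, mixedIdeal, Finset.coe_insert, Ideal.span_insert, sup_assoc, sup_comm]

theorem mixedIdeal_empty_right (q : ℕ) (A : Finset S) :
    mixedIdeal q A ∅ = Ideal.span (A : Set S) := by
  simp [mixedIdeal]

variable {s : Finset S}

/-- The induction removes `y` from `T` and needs the claim both for `A` and for `A` with `y` added;
hence the mixed ideals and the general `A`. -/
theorem IsPrimeSystem.mem_mixedIdeal_of_mul_mem [DecidableEq S] (hs : IsPrimeSystem s) (q : ℕ)
    {T A : Finset S} (hT : T ⊆ s) (hA : A ⊆ s) (hTA : Disjoint T A) {x : S} (hx : x ∈ s)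
    (hxT : x ∉ T) (hxA : x ∉ A) {z : S} (hz : x * z ∈ mixedIdeal q A T) :
    z ∈ mixedIdeal q A T := by
  induction T using Finset.induction_on generalizing A x z with
  | empty =>
    rw [mixedIdeal_empty_right] at hz ⊢
    exact ((hs A hA).1.mem_or_mem hz).resolve_left ((hs A hA).2 x hx hxA)
  | insert y T hyT ih =>
    rw [mixedIdeal_insert_right] at hz ⊢
    rw [Finset.insert_subset_iff] at hT
    rw [Finset.disjoint_insert_left] at hTA
    rw [Finset.mem_insert, not_or] at hxT
    refine mem_sup_span_pow_of_mul_mem (fun z hz => ih hT.2 hA hTA.2 hT.1 hyT hTA.1 hz)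
      (fun z hz => ?_) q hz
    rw [← mixedIdeal_insert_left] at hz ⊢
    refine ih hT.2 (Finset.insert_subset_iff.2 ⟨hT.1, hA⟩)
      (Finset.disjoint_insert_right.2 ⟨hyT, hTA.2⟩) hx hxT.2 ?_ hz
    rw [Finset.mem_insert, not_or]
    exact ⟨hxT.1, hxA⟩

/-- Cancelling `y^q` moves `y` from `T` to `A`. For `A` empty and `T = s` the product is the socle
generator modulo the powers of the parameters. -/
theorem IsPrimeSystem.prod_pow_notMem [DecidableEq S] (hs : IsPrimeSystem s) (q : ℕ)
    {T A : Finset S} (hT : T ⊆ s) (hA : A ⊆ s) (hTA : Disjoint T A) :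
    ∏ x ∈ T, x ^ q ∉ mixedIdeal (q + 1) A T := by
  induction T using Finset.induction_on generalizing A with
  | empty =>
    rw [mixedIdeal_empty_right, Finset.prod_empty]
    exact (Ideal.ne_top_iff_one _).1 (hs A hA).1.ne_top
  | insert y T hyT ih =>
    rw [mixedIdeal_insert_right, Finset.prod_insert hyT]
    rw [Finset.insert_subset_iff] at hT
    rw [Finset.disjoint_insert_left] at hTA
    intro h
    refine ih hT.2 (A := insert y A) (Finset.insert_subset_iff.2 ⟨hT.1, hA⟩)
      (Finset.disjoint_insert_right.2 ⟨hyT, hTA.2⟩) ?_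
    have hreg : ∀ r z, y ^ r * z ∈ mixedIdeal (q + 1) A T → z ∈ mixedIdeal (q + 1) A T := by
      intro r
      induction r with
      | zero => simp
      | succ r ihr =>
        intro z hz
        rw [pow_succ, mul_assoc] at hz
        exact hs.mem_mixedIdeal_of_mul_mem (q + 1) hT.2 hA hTA.2 hT.1 hyT hTA.1 (ihr _ hz)
    obtain ⟨w, hw, t, ht, hwt⟩ := Submodule.mem_sup.1 h
    obtain ⟨t, rfl⟩ := Ideal.mem_span_singleton.1 ht
    have h1 : y ^ q * (∏ x ∈ T, x ^ q - y * t) ∈ mixedIdeal (q + 1) A T := by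
      have : y ^ q * (∏ x ∈ T, x ^ q - y * t) = w := by
        rw [pow_succ] at hwt
        linear_combination -hwt
      rwa [this]
    rw [mixedIdeal_insert_left, ← sub_add_cancel (∏ x ∈ T, x ^ q) (y * t)]
    exact add_mem (Ideal.mem_sup_left (hreg q _ h1))
      (Ideal.mem_sup_right (Ideal.mul_mem_right _ _ (Ideal.mem_span_singleton_self y)))

end RegularSystem

/-! ### Flatness of the Frobenius endomorphism of a regular ring -/

section Kunz

open IsLocalRing RingTheory.Sequence

theorem IsPrimeSystem.isWeaklyRegular_map_pow {S : Type*} [CommRing S] {s : Finset S}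
    (hs : IsPrimeSystem s) (q : ℕ) {l : List S} (hl : l.Nodup) (hls : ∀ x ∈ l, x ∈ s) :
    IsWeaklyRegular S (l.map fun x => x ^ q) := by
  classical
  rw [isWeaklyRegular_iff_Fin]
  rintro ⟨i, hi⟩
  rw [List.length_map] at hi
  rw [isSMulRegular_quotient_iff_mem_of_smul_mem]
  have hI : (Ideal.ofList ((l.map fun x => x ^ q).take i) • ⊤ : Ideal S) =
      mixedIdeal q ∅ (l.take i).toFinset := by
    rw [smul_eq_mul, Ideal.mul_top, mixedIdeal, Finset.coe_empty, Ideal.span_empty, bot_sup_eq,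
      ← List.map_take, Ideal.ofList]
    congr 1
    ext x
    simp only [List.mem_map, Set.mem_image, List.coe_toFinset, Set.mem_ofPred_eq]
  have hnot : l[i] ∉ l.take i := by
    intro h
    obtain ⟨j, hj, hji⟩ := List.mem_take_iff_getElem.1 h
    have := (hl.getElem_inj_iff).1 hji
    omega
  have hreg : ∀ r z, l[i] ^ r * z ∈ mixedIdeal q ∅ (l.take i).toFinset →
      z ∈ mixedIdeal q ∅ (l.take i).toFinset := by
    intro r
    induction r with
    | zero => simp
    | succ r ihr =>
      intro z hz
      rw [pow_succ, mul_assoc] at hz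
      refine hs.mem_mixedIdeal_of_mul_mem q (fun x hx => ?_) (Finset.empty_subset _)
        (Finset.disjoint_empty_right _) (hls _ (List.getElem_mem hi)) ?_ (Finset.notMem_empty _)
        (ihr _ hz)
      · exact hls x (List.mem_of_mem_take (List.mem_toFinset.1 hx))
      · rwa [List.mem_toFinset]
  intro z hz
  simp only [hI] at hz ⊢
  refine hreg q z ?_
  simpa using hz

/-- Freeness lifts from `M / r M` over `S / (r)` when `r` is regular on `M`; at the end of the
sequence the base is a field. -/
theorem free_of_isWeaklyRegular {S M : Type*} [CommRing S] [IsLocalRing S] [IsNoetherianRing S]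
    [AddCommGroup M] [Module S M] [Module.Finite S M] (rs : List S)
    (hrs : Ideal.ofList rs = maximalIdeal S) (h : IsWeaklyRegular M rs) : Module.Free S M := by
  induction hn : rs.length generalizing S M rs with
  | zero =>
    rw [List.length_eq_zero_iff.1 hn, Ideal.ofList_nil] at hrs
    let := (isField_iff_maximalIdeal_eq.2 hrs.symm).toField
    exact Module.Free.of_divisionRing S M
  | succ d ih =>
    obtain ⟨r, rs, rfl⟩ := List.exists_cons_of_length_eq_add_one hn
    rw [isWeaklyRegular_cons_iff'] at h
    have hr : Ideal.span {r} ≤ maximalIdeal S := by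
      rw [← hrs, Ideal.ofList_cons]
      exact le_sup_left
    have hloc := isLocalRing_quotient hr
    have : Module.Finite (S ⧸ Ideal.span {r}) (QuotSMulTop r M) :=
      Module.Finite.of_restrictScalars_finite S _ _
    have := Module.finitePresentation_of_finite S M
    rw [← Module.free_quotSMulTop_iff_free S M (x := r) ?_ h.1]
    · refine ih _ ?_ h.2 ?_
      · rw [← Ideal.map_ofList, ← map_maximalIdeal_of_surjective
          (Ideal.Quotient.mk (Ideal.span {r})) Ideal.Quotient.mk_surjective, ← hrs,
          Ideal.ofList_cons, Ideal.map_sup, Ideal.map_quotient_self, bot_sup_eq]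
      · simpa using hn
    · rw [IsLocalRing.jacobson_eq_maximalIdeal _ bot_ne_top]
      rwa [Ideal.span_singleton_le_iff_mem] at hr

theorem flat_of_isWeaklyRegular_map {S S' : Type*} [CommRing S] [IsLocalRing S]
    [IsNoetherianRing S] [CommRing S'] (f : S →+* S') (hf : f.Finite) (rs : List S)
    (hrs : Ideal.ofList rs = maximalIdeal S) (h : IsWeaklyRegular S' (rs.map f)) : f.Flat := by
  algebraize [f]
  have hreg : IsWeaklyRegular S' rs := (isWeaklyRegular_map_algebraMap_iff S' S' rs).1 h
  have := free_of_isWeaklyRegular rs hrs hreg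
  exact (inferInstance : Module.Flat S S')

/-- This direction of Kunz's theorem holds because `p`-th powers of the parameters again form a
weakly regular sequence. -/
theorem flat_frobenius_of_isRegularLocalRing {S : Type*} [CommRing S] [IsRegularLocalRing S]
    (p : ℕ) [ExpChar S p] (hf : (frobenius S p).Finite) : (frobenius S p).Flat := by
  obtain ⟨s, hs, -, hsp⟩ := exists_isPrimeSystem S
  refine flat_of_isWeaklyRegular_map _ hf s.toList ?_ ?_
  · rw [← hs, Ideal.ofList]
    congr 1
    ext x
    simp
  · exact hsp.isWeaklyRegular_map_pow p s.nodup_toList fun x hx => Finset.mem_toList.1 hx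

theorem localRingHom_frobenius {R : Type*} [CommRing R] (p : ℕ) [ExpChar R p] (J : Ideal R)
    [J.IsPrime] [ExpChar (Localization.AtPrime J) p] (h : J = J.comap (frobenius R p)) :
    Localization.localRingHom J J (frobenius R p) h = frobenius (Localization.AtPrime J) p := by
  refine IsLocalization.ringHom_ext J.primeCompl ?_
  ext x
  simp [Localization.localRingHom_to_map, frobenius_def]

/-- Inverting the `p`-th powers of the complement of `J` inverts the whole complement, so finiteness
localizes on source and target at once. -/
theorem finite_frobenius_localization {R : Type*} [CommRing R] (p : ℕ) [Fact p.Prime]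
    [CharP R p] (hf : (frobenius R p).Finite) (J : Ideal R)
    [J.IsPrime] [CharP (Localization.AtPrime J) p] :
    (frobenius (Localization.AtPrime J) p).Finite := by
  let M := J.primeCompl.map (frobenius R p)
  have hle : M ≤ J.primeCompl := by
    rintro _ ⟨x, hx, rfl⟩
    exact pow_mem hx p
  have h1 : IsLocalization J.primeCompl (Localization M) := by
    refine IsLocalization.of_le_of_exists_dvd M J.primeCompl hle fun x hx => ?_
    exact ⟨_, ⟨x, hx, rfl⟩, dvd_pow_self x (Fact.out : p.Prime).ne_zero⟩
  have h2 : IsLocalization M (Localization.AtPrime J) :=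
    IsLocalization.isLocalization_of_algEquiv M
      (IsLocalization.algEquiv J.primeCompl (Localization M) (Localization.AtPrime J))
  have h3 := RingHom.finite_localizationPreserves (frobenius R p) J.primeCompl
    (Localization.AtPrime J) (Localization.AtPrime J) hf
  convert h3
  refine (IsLocalization.ringHom_ext J.primeCompl ?_).symm
  ext x
  simp [frobenius_def]

theorem flat_frobenius_of_isRegularRing {R : Type*} [CommRing R] [IsDomain R] [IsRegularRing R]
    (p : ℕ) [Fact p.Prime] [CharP R p] (hf : (frobenius R p).Finite) : (frobenius R p).Flat := by
  refine RingHom.Flat.ofLocalizationPrime _ fun J hJ => ?_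
  have : CharP (Localization.AtPrime J) p := charP_of_injective_algebraMap
    (IsLocalization.injective (Localization.AtPrime J) J.primeCompl_le_nonZeroDivisors) p
  have hcomap : J = J.comap (frobenius R p) := by
    ext x
    rw [Ideal.mem_comap, frobenius_def]
    exact (hJ.pow_mem_iff_mem _ (Fact.out : p.Prime).pos).symm
  have key : ∀ (I : Ideal R) [I.IsPrime] (h : I = J.comap (frobenius R p)),
      (Localization.localRingHom I J (frobenius R p) h).Flat →
      (Localization.localRingHom (J.comap (frobenius R p)) J (frobenius R p) rfl).Flat := by
    intro I _ h hI
    subst h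
    exact hI
  refine key J hcomap ?_
  rw [localRingHom_frobenius]
  exact flat_frobenius_of_isRegularLocalRing p (finite_frobenius_localization p hf J)

theorem finite_iterateFrobenius {R : Type*} [CommRing R] {p : ℕ} [ExpChar R p]
    (hf : (frobenius R p).Finite) (e : ℕ) : (iterateFrobenius R p e).Finite := by
  induction e with
  | zero =>
    rw [iterateFrobenius_zero]
    exact RingHom.Finite.id R
  | succ e ih =>
    rw [iterateFrobenius_add, iterateFrobenius_one]
    exact ih.comp hf

theorem flat_iterateFrobenius {R : Type*} [CommRing R] {p : ℕ} [ExpChar R p]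
    (hf : (frobenius R p).Flat) (e : ℕ) : (iterateFrobenius R p e).Flat := by
  induction e with
  | zero =>
    rw [iterateFrobenius_zero]
    exact RingHom.Flat.id R
  | succ e ih =>
    rw [iterateFrobenius_add, iterateFrobenius_one]
    exact RingHom.Flat.comp hf ih

/-- For a finite flat homomorphism from a Noetherian ring, an element outside the extension of `m`
produces an element outside `m` lying in every ideal whose extension contains it. -/
theorem exists_notMem_of_notMem_map {A B : Type*} [CommRing A] [IsNoetherianRing A] [CommRing B]
    (f : A →+* B) (hfin : f.Finite) (hflat : f.Flat) {m : Ideal A} {h : B} (hh : h ∉ m.map f) :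
    ∃ c ∉ m, ∀ J : Ideal A, h ∈ J.map f → c ∈ J := by
  algebraize [f]
  have : Module.Flat A B := hflat
  have : Module.Finite A B := hfin
  have := Module.finitePresentation_of_finite A B
  have : Module.Projective A B := Module.Flat.projective_of_finitePresentation
  obtain ⟨σ, hσ⟩ := Module.projective_def'.1 this
  -- The coordinates of `h` under the splitting `σ` are the candidates for `c`: they lie in `J`
  -- whenever `h ∈ J B`, and if all were in `m` then `h ∈ m B`.
  have hmap : ∀ (φ : B →ₗ[A] A) (J : Ideal A), ∀ x ∈ J.map (algebraMap A B), φ x ∈ J := by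
    intro φ J x hx
    rw [Ideal.map] at hx
    induction hx using Submodule.span_induction generalizing φ with
    | mem x hx =>
      obtain ⟨a, ha, rfl⟩ := hx
      rw [Algebra.algebraMap_eq_smul_one, map_smul]
      exact J.mul_mem_right _ ha
    | zero => simp
    | add x y _ _ hx hy =>
      rw [map_add]
      exact add_mem (hx φ) (hy φ)
    | smul b x _ ih => exact ih (φ.comp (LinearMap.mulLeft A b))
  by_contra hcon
  push Not at hcon
  have hmem : ∀ i, σ h i ∈ m := by
    intro i
    by_contra hi
    obtain ⟨J, hJ, hcJ⟩ := hcon _ hi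
    exact hcJ (hmap ((Finsupp.lapply i).comp σ) J h hJ)
  refine hh ?_
  have := LinearMap.congr_fun hσ h
  rw [LinearMap.id_apply, LinearMap.comp_apply, Finsupp.linearCombination_apply] at this
  rw [← this]
  refine Ideal.sum_mem _ fun i _ => ?_
  dsimp only
  rw [Algebra.smul_def]
  exact Ideal.mul_mem_right _ _ (Ideal.mem_map_of_mem _ (hmem i))

/-- A proper test ideal of a principal ideal in an `F`-finite regular domain is detected at a
maximal ideal. -/
theorem testIdeal_span_singleton_ne_top_iff_exists {R : Type*} [CommRing R] [IsDomain R]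
    [IsRegularRing R] {p : ℕ} [Fact p.Prime] [CharP R p] (hf : (frobenius R p).Finite) (g : R)
    (c : ℝ) : testIdeal p (Ideal.span {g}) c ≠ ⊤ ↔
      ∃ m : Ideal R, m.IsMaximal ∧ ∀ e : ℕ, g ^ ⌈c * (p : ℝ) ^ e⌉₊ ∈ frobPower p e m := by
  constructor
  · intro h
    obtain ⟨m, hm, hle⟩ := Ideal.exists_le_maximal _ h
    refine ⟨m, hm, fun e => ?_⟩
    by_contra hg
    obtain ⟨x, hx, hxJ⟩ := exists_notMem_of_notMem_map (iterateFrobenius R p e)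
      (finite_iterateFrobenius hf e)
      (flat_iterateFrobenius (flat_frobenius_of_isRegularRing p hf) e) hg
    refine hx (hle ((le_iSup (fun e => frobRoot p e (Ideal.span {g} ^ ⌈c * (p : ℝ) ^ e⌉₊)) e) ?_))
    rw [frobRoot, Ideal.mem_sInf]
    intro J hJ
    refine hxJ J (hJ ?_)
    rw [Ideal.span_singleton_pow]
    exact Ideal.mem_span_singleton_self _
  · rintro ⟨m, hm, h⟩ htop
    refine hm.ne_top (top_le_iff.1 (htop ▸ iSup_le fun e => frobRoot_le ?_))
    rw [Ideal.span_singleton_pow, Ideal.span_singleton_le_iff_mem]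
    exact h e

end Kunz

/-! ### Coefficient fields -/

section CoefficientField

open Polynomial

/-- A square-zero extension of a field of characteristic `p` splits. -/
theorem exists_section_of_sq_zero {p : ℕ} [Fact p.Prime] {B κ : Type*} [CommRing B] [CharP B p]
    [Field κ] [CharP κ p] (π : B →+* κ) (hπ : Function.Surjective π)
    (hsq : ∀ x y, π x = 0 → π y = 0 → x * y = 0) : ∃ g : κ →+* B, π.comp g = RingHom.id κ := by
  have hp := (Fact.out : p.Prime)
  have : Nontrivial B := hπ.nontrivial
  have hnil : ∀ b, π b = 0 → b ^ p = 0 := by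
    intro b hb
    obtain ⟨r, hr⟩ := Nat.exists_eq_add_of_le hp.two_le
    rw [hr, pow_add, sq, hsq b b hb hb, zero_mul]
  -- The image of the section will be a maximal subring that contains all `p`-th powers and meets
  -- the kernel only in zero.
  let 𝒮 : Set (Subring B) := {C | (∀ b, b ^ p ∈ C) ∧ ∀ c ∈ C, π c = 0 → c = 0}
  have h0 : (frobenius B p).range ∈ 𝒮 := by
    refine ⟨fun b => ⟨b, rfl⟩, ?_⟩
    rintro _ ⟨b, rfl⟩ hb
    rw [frobenius_def, map_pow] at hb
    exact hnil b (eq_zero_of_pow_eq_zero hb)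
  obtain ⟨C, -, hC⟩ := zorn_le_nonempty₀ 𝒮 (fun c hc hchain y hy => by
    have hmem : ∀ x, x ∈ sSup c ↔ ∃ C ∈ c, x ∈ C := fun x =>
      Subring.mem_sSup_of_directedOn ⟨y, hy⟩ hchain.directedOn
    refine ⟨sSup c, ⟨fun b => (hmem _).2 ⟨y, hy, (hc hy).1 b⟩, fun x hx hx0 => ?_⟩,
      fun z hz => le_sSup hz⟩
    obtain ⟨C, hCc, hxC⟩ := (hmem x).1 hx
    exact (hc hCc).2 x hxC hx0) _ h0
  obtain ⟨hCp, hC0⟩ := hC.prop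
  let F : Subfield κ :=
    { C.map π with
      inv_mem' := by
        rintro _ ⟨c, hc, rfl⟩
        obtain ⟨b, hb⟩ := hπ (π c)⁻¹
        by_cases hc0 : π c = 0
        · refine ⟨0, C.zero_mem, ?_⟩
          simp [hc0]
        · refine ⟨c ^ (p - 1) * b ^ p, C.mul_mem (C.pow_mem hc _) (hCp b), ?_⟩
          rw [map_mul, map_pow, map_pow, hb, inv_pow, ← div_eq_mul_inv]
          rw [div_eq_iff (pow_ne_zero _ hc0), ← pow_sub_one_mul hp.ne_zero,
            mul_comm (π c ^ (p - 1)), ← mul_assoc, inv_mul_cancel₀ hc0, one_mul] }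
  have hF : ∀ x, x ∈ F ↔ ∃ c ∈ C, π c = x := fun x => Iff.rfl
  have hsurj : ∀ t : κ, ∃ c ∈ C, π c = t := by
    intro t
    -- If `t` is missed, its minimal polynomial over `F` is `X^p - t^p`. Reducing modulo `X^p - τ^p`
    -- shows that `C[τ]` still meets the kernel trivially, against maximality.
    by_contra ht
    obtain ⟨τ, hτ⟩ := hπ t
    have htp : t ^ p ∈ F := (hF _).2 ⟨τ ^ p, hCp τ, by rw [map_pow, hτ]⟩
    have hirr : Irreducible (X ^ p - Polynomial.C (⟨t ^ p, htp⟩ : F)) := by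
      refine X_pow_sub_C_irreducible_of_prime hp fun b hb => ht ?_
      have hb' : (b : κ) ^ p = t ^ p := congrArg Subtype.val hb
      have : (b : κ) = t := frobenius_inj κ p hb'
      exact (hF t).1 (this ▸ b.2)
    have hmon : (X ^ p - Polynomial.C (⟨t ^ p, htp⟩ : F)).Monic := monic_X_pow_sub_C _ hp.ne_zero
    have hmin : minpoly F t = X ^ p - Polynomial.C (⟨t ^ p, htp⟩ : F) := by
      refine (minpoly.eq_of_irreducible_of_monic hirr ?_ hmon).symm
      rw [map_sub, map_pow, aeval_X, aeval_C]
      exact sub_self _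
    let ρ : C →+* F := (π.comp C.subtype).codRestrict F fun c => (hF _).2 ⟨c, c.2, rfl⟩
    have hρ : ∀ c, ρ c = 0 → c = 0 := fun c hc =>
      Subtype.ext (hC0 c c.2 (congrArg Subtype.val hc))
    let D : Subring B := (Algebra.adjoin C {τ}).toSubring
    have hCD : C ≤ D := fun c hc => (Algebra.adjoin C {τ}).algebraMap_mem ⟨c, hc⟩
    have hD : D ∈ 𝒮 := by
      refine ⟨fun b => hCD (hCp b), fun x hx hx0 => ?_⟩
      have hx' : x ∈ Algebra.adjoin C {τ} := hx
      rw [Algebra.adjoin_singleton_eq_range_aeval] at hx'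
      obtain ⟨P, rfl⟩ := hx'
      have hmonC : (X ^ p - Polynomial.C (⟨τ ^ p, hCp τ⟩ : C)).Monic :=
        monic_X_pow_sub_C _ hp.ne_zero
      set Q := P %ₘ (X ^ p - Polynomial.C (⟨τ ^ p, hCp τ⟩ : C)) with hQ
      have hroot : aeval τ (X ^ p - Polynomial.C (⟨τ ^ p, hCp τ⟩ : C)) = 0 := by
        rw [map_sub, map_pow, aeval_X, aeval_C]
        exact sub_self _
      have hPQ : aeval τ P = aeval τ Q := by
        rw [hQ, aeval_modByMonic_eq_self_of_root hroot]
      have hQdeg : Q.degree < p := by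
        have := degree_modByMonic_lt P hmonC
        rwa [degree_X_pow_sub_C hp.pos] at this
      have hQ0 : Q.map ρ = 0 := by
        by_contra hne
        have h1 : aeval t (Q.map ρ) = 0 := by
          have : aeval t (Q.map ρ) = π (aeval τ Q) := by
            rw [aeval_def, eval₂_map, aeval_def, hom_eval₂, hτ]
            rfl
          rw [this, ← hPQ]
          exact hx0
        have h2 := minpoly.degree_le_of_ne_zero F t hne h1
        rw [hmin, degree_X_pow_sub_C hp.pos] at h2
        exact absurd (h2.trans (degree_map_le)) (not_le.2 hQdeg)
      have hQz : Q = 0 := by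
        ext1 i
        refine hρ _ ?_
        rw [← coeff_map, hQ0, coeff_zero]
      show aeval τ P = 0
      rw [hPQ, hQz, map_zero]
    have hτC : τ ∈ C := hC.le_of_ge hD hCD (Algebra.subset_adjoin (Set.mem_singleton τ))
    exact ht ⟨τ, hτC, hτ⟩
  let ε : C ≃+* κ := RingEquiv.ofBijective (π.comp C.subtype)
    ⟨(injective_iff_map_eq_zero _).2 fun c hc => Subtype.ext (hC0 c c.2 hc), fun t => by
      obtain ⟨c, hc, hct⟩ := hsurj t
      exact ⟨⟨c, hc⟩, hct⟩⟩
  refine ⟨C.subtype.comp (ε.symm : κ →+* C), ?_⟩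
  ext t
  exact ε.apply_symm_apply t

/-- It suffices to split one square-zero extension of `κ`, coming from a polynomial ring; no
perfectness of `κ` is needed. -/
theorem formallySmooth_zmod (p : ℕ) [Fact p.Prime] (κ : Type*) [Field κ] [CharP κ p]
    [Algebra (ZMod p) κ] : Algebra.FormallySmooth (ZMod p) κ := by
  let f : MvPolynomial κ (ZMod p) →ₐ[ZMod p] κ := MvPolynomial.aeval id
  have hf : Function.Surjective f := fun a => ⟨MvPolynomial.X a, by simp [f]⟩
  rw [Algebra.FormallySmooth.iff_split_surjection f hf]
  have hsurj : Function.Surjective f.kerSquareLift := fun a => by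
    obtain ⟨b, hb⟩ := hf a
    exact ⟨Ideal.Quotient.mk (RingHom.ker f.toRingHom ^ 2) b, hb⟩
  have hnt : Nontrivial (MvPolynomial κ (ZMod p) ⧸ RingHom.ker f.toRingHom ^ 2) :=
    hsurj.nontrivial
  have hchar : CharP (MvPolynomial κ (ZMod p) ⧸ RingHom.ker f.toRingHom ^ 2) p :=
    charP_of_injective_algebraMap (algebraMap (ZMod p) _).injective p
  obtain ⟨g, hg⟩ := exists_section_of_sq_zero (p := p)
    (B := MvPolynomial κ (ZMod p) ⧸ RingHom.ker f.toRingHom ^ 2) f.kerSquareLift.toRingHom hsurj (by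
    intro x y hx hy
    obtain ⟨x, rfl⟩ := Ideal.Quotient.mk_surjective x
    obtain ⟨y, rfl⟩ := Ideal.Quotient.mk_surjective y
    rw [← map_mul, Ideal.Quotient.eq_zero_iff_mem, sq]
    exact Ideal.mul_mem_mul hx hy)
  refine ⟨{ g with commutes' := fun r => ?_ }, ?_⟩
  · exact RingHom.congr_fun (Subsingleton.elim (g.comp (algebraMap (ZMod p) κ)) (algebraMap _ _)) r
  · ext a
    exact RingHom.congr_fun hg a

end CoefficientField

/-! ### Polynomial models of regular local rings -/

section Model

open MvPolynomial IsLocalRing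

/-- Every polynomial outside `(x₁^q, …, xₙ^q)` has a monomial multiple congruent to a nonzero
multiple of `(x₁ ⋯ xₙ)^(q-1)`. -/
theorem exists_mul_monomial_sub_mem_monPow {d q : ℕ} {κ : Type*} [Field κ]
    {h : MvPolynomial (Fin d) κ} (hh : h ∉ monPow d κ (q + 1)) :
    ∃ (v : Fin d →₀ ℕ) (c : κ), c ≠ 0 ∧
      h * monomial v 1 - C c * ∏ i, X i ^ q ∈ monPow d κ (q + 1) := by
  classical
  rw [mem_monPow_iff] at hh
  push Not at hh
  obtain ⟨u₀, hu₀, hc₀⟩ := hh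
  let F := h.support.filter fun u => ∀ i, u i < q + 1
  -- Multiplying by `x^(q - u)` sends `u` to the top corner of the box; any other exponent that
  -- stays in the box would lie below `u`, contradicting minimality.
  obtain ⟨u, huF⟩ := F.exists_minimal ⟨u₀, Finset.mem_filter.2 ⟨mem_support_iff.2 hc₀, hu₀⟩⟩
  have hu := (Finset.mem_filter.1 huF.prop).2
  have hcu := mem_support_iff.1 (Finset.mem_filter.1 huF.prop).1
  let v : Fin d →₀ ℕ := Finsupp.equivFunOnFinite.symm fun i => q - u i
  have huv : ∀ i, u i + v i = q := fun i => by
    have := hu i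
    simp only [v, Finsupp.equivFunOnFinite_symm_apply_apply]
    omega
  have hprod : (C (coeff u h) * ∏ i, X i ^ q : MvPolynomial (Fin d) κ) =
      monomial (u + v) (coeff u h) := by
    rw [monomial_eq, Finsupp.prod_fintype _ _ (by simp)]
    simp [huv]
  refine ⟨v, coeff u h, hcu, ?_⟩
  rw [hprod, mem_monPow_iff]
  intro w hw
  rw [coeff_sub, coeff_mul_monomial', coeff_monomial, sub_eq_zero, mul_one]
  split_ifs with h1 h2 h2
  · rw [← h2, add_tsub_cancel_right]
  · by_contra hne
    have hle : w - v ≤ u := fun i => by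
      have h3 := hw i
      have h4 := huv i
      rw [Finsupp.tsub_apply]
      omega
    have hmem : w - v ∈ F :=
      Finset.mem_filter.2 ⟨mem_support_iff.2 hne, fun i => (hle i).trans_lt (hu i)⟩
    have := le_antisymm hle (huF.le_of_le hmem hle)
    exact h2 (by rw [← this, tsub_add_cancel_of_le h1])
  · exact absurd (h2 ▸ le_add_self) h1
  · rfl

/-- Formal smoothness lifts the identity of the residue field through the nilpotent thickening `S /
m^(N+1)`; the lift recovers `a` only up to `m`. -/
theorem exists_coefficientField {p : ℕ} [Fact p.Prime] {S : Type*} [CommRing S] [IsLocalRing S]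
    [CharP S p] (N : ℕ) :
    ∃ σ : ResidueField S →+* S ⧸ maximalIdeal S ^ (N + 1), ∀ a : S, ∃ b ∈ maximalIdeal S,
      σ (residue S a) = Ideal.Quotient.mk _ (a - b) := by
  let _ : Algebra (ZMod p) S := ZMod.algebra S p
  have hchar : CharP (ResidueField S) p :=
    charP_of_injective_algebraMap (algebraMap (ZMod p) _).injective p
  have := formallySmooth_zmod p (ResidueField S)
  let π : (S ⧸ maximalIdeal S ^ (N + 1)) →+* ResidueField S :=
    Ideal.Quotient.lift _ (residue S) fun a ha =>
      (residue_eq_zero_iff a).2 (Ideal.pow_le_self N.succ_ne_zero ha)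
  let π' : (S ⧸ maximalIdeal S ^ (N + 1)) →ₐ[ZMod p] ResidueField S :=
    { π with
      commutes' := fun r =>
        RingHom.congr_fun (Subsingleton.elim (π.comp (algebraMap (ZMod p) _)) (algebraMap _ _)) r }
  have hsurj : Function.Surjective π' := fun x => by
    obtain ⟨a, rfl⟩ := residue_surjective x
    exact ⟨Ideal.Quotient.mk _ a, rfl⟩
  have hker : RingHom.ker (π' : (S ⧸ maximalIdeal S ^ (N + 1)) →+* ResidueField S) ≤
      (maximalIdeal S).map (Ideal.Quotient.mk _) := by
    intro x hx
    obtain ⟨a, rfl⟩ := Ideal.Quotient.mk_surjective x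
    exact Ideal.mem_map_of_mem _ ((residue_eq_zero_iff a).1 hx)
  have hnil : IsNilpotent
      (RingHom.ker (π' : (S ⧸ maximalIdeal S ^ (N + 1)) →+* ResidueField S)) := by
    refine ⟨N + 1, le_bot_iff.1 ((Ideal.pow_right_mono hker _).trans ?_)⟩
    rw [← Ideal.map_pow, Ideal.map_quotient_self]
  let σ := Algebra.FormallySmooth.liftOfSurjective (AlgHom.id (ZMod p) (ResidueField S)) π' hsurj
    hnil
  have hσ : ∀ x, π' (σ x) = x := fun x =>
    Algebra.FormallySmooth.liftOfSurjective_apply (AlgHom.id (ZMod p) (ResidueField S)) π' hsurj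
      hnil x
  refine ⟨σ, fun a => ?_⟩
  obtain ⟨a', ha'⟩ := Ideal.Quotient.mk_surjective (σ (residue S a))
  refine ⟨a - a', ?_, ?_⟩
  · rw [← residue_eq_zero_iff, map_sub, sub_eq_zero]
    have := hσ (residue S a)
    rw [← ha'] at this
    exact this.symm
  · rw [sub_sub_cancel]
    exact ha'.symm

theorem frobPower_le_of_le {R : Type*} [CommRing R] {p : ℕ} [Fact p.Prime] {e E : ℕ} (h : e ≤ E)
    (J : Ideal R) : frobPower p E J ≤ frobPower p e J := by
  rw [frobPower, Ideal.span_le]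
  rintro _ ⟨u, hu, rfl⟩
  obtain ⟨r, rfl⟩ := Nat.exists_eq_add_of_le' h
  show u ^ p ^ (r + e) ∈ _
  rw [pow_add, pow_mul]
  exact pow_mem_frobPower e (J.pow_mem_of_mem hu _ (pow_pos (Fact.out : p.Prime).pos r))

/-- The Frobenius powers of the maximal ideal of a regular local ring of characteristic `p`, tested
on the powers of a single element, agree with those of the origin of a polynomial ring. -/
theorem exists_polynomial_model {p : ℕ} [Fact p.Prime] {S : Type*} [CommRing S]
    [IsRegularLocalRing S] [CharP S p] (g : S) (E : ℕ) :
    ∃ (d : ℕ) (f : MvPolynomial (Fin d) (ResidueField S)), (d : WithBot ℕ∞) = ringKrullDim S ∧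
      ∀ e ≤ E, ∀ b : ℕ, f ^ b ∈ monPow d (ResidueField S) (p ^ e) ↔
        g ^ b ∈ frobPower p e (maximalIdeal S) := by
  classical
  obtain ⟨s, hs, hdim, hsp⟩ := exists_isPrimeSystem S
  let x : Fin s.card → S := fun i => s.equivFin.symm i
  have hrange : Set.range x = s := by
    rw [Set.range_comp' Subtype.val s.equivFin.symm, s.equivFin.symm.surjective.range_eq,
      Set.image_univ, Subtype.range_coe]
  have hxspan : maximalIdeal S = Ideal.span (Set.range x) := by rw [hrange, hs]
  -- Truncating modulo `m^(N+1)` then loses nothing about Frobenius powers up to level `E`.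
  obtain ⟨N, hN⟩ : ∃ N, maximalIdeal S ^ (N + 1) ≤ frobPower p E (maximalIdeal S) := by
    obtain ⟨N, hN⟩ := Ideal.exists_pow_le_of_le_radical_of_fg (I := maximalIdeal S)
      (J := frobPower p E (maximalIdeal S)) (fun a ha => ⟨p ^ E, pow_mem_frobPower E ha⟩)
      (maximalIdeal S).fg_of_isNoetherianRing
    exact ⟨N, (Ideal.pow_le_pow_right N.le_succ).trans hN⟩
  obtain ⟨σ, hσ⟩ := exists_coefficientField (p := p) (S := S) N
  let mk := Ideal.Quotient.mk (maximalIdeal S ^ (N + 1))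
  let ψ : MvPolynomial (Fin s.card) (ResidueField S) →+* S ⧸ maximalIdeal S ^ (N + 1) :=
    eval₂Hom σ fun i => mk (x i)
  -- Successive approximation; at `j = N + 1` it shows that `ψ` is surjective.
  have happrox : ∀ (j : ℕ) (a : S), ∃ f, ∃ b ∈ maximalIdeal S ^ j, ψ f = mk (a - b) := by
    intro j
    induction j with
    | zero => exact fun a => ⟨0, a, by simp, by simp⟩
    | succ j ih =>
      intro a
      obtain ⟨b, hb, hab⟩ := hσ a
      rw [hxspan, Ideal.mem_span_range_iff_exists_fun] at hb
      obtain ⟨c, rfl⟩ := hb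
      choose f r hr hf using fun i => ih (c i)
      refine ⟨C (residue S a) + ∑ i, f i * X i, ∑ i, r i * x i, Ideal.sum_mem _ fun i _ => ?_, ?_⟩
      · rw [pow_succ]
        refine Ideal.mul_mem_mul (hr i) ?_
        rw [hxspan]
        exact Ideal.subset_span ⟨i, rfl⟩
      · have h1 : ψ (C (residue S a)) = mk (a - ∑ i, c i * x i) := by
          rw [← hab]
          simp [ψ]
        have h2 : ∀ i, ψ (X i) = mk (x i) := fun i => by simp [ψ]
        rw [map_add, h1, map_sum]
        simp only [map_mul, h2, hf]
        simp only [← map_mul, ← map_sum, ← map_add]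
        congr 1
        simp only [sub_mul, Finset.sum_sub_distrib]
        ring
  obtain ⟨f, b, hb, hf⟩ := happrox (N + 1) g
  have hfg : ψ f = mk g := by
    rw [hf, map_sub, Ideal.Quotient.eq_zero_iff_mem.2 hb, sub_zero]
  refine ⟨s.card, f, hdim, fun e he b => ?_⟩
  set I := frobPower p e (maximalIdeal S) with hI
  have hNI : maximalIdeal S ^ (N + 1) ≤ I := hN.trans (frobPower_le_of_le he _)
  have hIx : I = Ideal.span (Set.range fun i => x i ^ p ^ e) := by
    rw [hI, hxspan, frobPower_span_range]
  have hmap : (monPow s.card (ResidueField S) (p ^ e)).map ψ ≤ I.map mk := by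
    rw [monPow, Ideal.map_span, Ideal.span_le]
    rintro _ ⟨_, ⟨i, rfl⟩, rfl⟩
    have : ψ (X i ^ p ^ e) = mk (x i ^ p ^ e) := by simp [ψ]
    rw [SetLike.mem_coe, this, hIx]
    exact Ideal.mem_map_of_mem _ (Ideal.subset_span ⟨i, rfl⟩)
  have hbg : ψ (f ^ b) = mk (g ^ b) := by rw [map_pow, map_pow, hfg]
  rw [← Ideal.mem_quotient_iff_mem hNI, ← hbg]
  refine ⟨fun h => hmap (Ideal.mem_map_of_mem ψ h), fun h => ?_⟩
  -- Otherwise a monomial multiple of `f ^ b` would place a unit times the socle element in `I`,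
  -- which `prod_pow_notMem` forbids.
  by_contra hcon
  obtain ⟨q, hq⟩ : ∃ q, p ^ e = q + 1 :=
    Nat.exists_eq_succ_of_ne_zero (pow_pos (Fact.out : p.Prime).pos e).ne'
  rw [hq] at hcon hmap
  obtain ⟨v, c, hc, hmem⟩ := exists_mul_monomial_sub_mem_monPow hcon
  have h1 := hmap (Ideal.mem_map_of_mem ψ hmem)
  rw [map_sub, map_mul, map_mul] at h1
  have h2 : ψ (C c) * ψ (∏ i, X i ^ q) ∈ I.map mk := by
    have := sub_mem (Ideal.mul_mem_right (ψ (monomial v 1)) _ h) h1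
    rwa [sub_sub_cancel] at this
  have hunit : IsUnit (ψ (C c)) := ((isUnit_iff_ne_zero.2 hc).map C).map ψ
  rw [Ideal.unit_mul_mem_iff_mem _ hunit] at h2
  have h3 : ψ (∏ i, X i ^ q) = mk (∏ i, x i ^ q) := by simp [ψ]
  rw [h3, Ideal.mem_quotient_iff_mem hNI] at h2
  refine hsp.prod_pow_notMem q (Finset.Subset.refl s) (Finset.empty_subset s)
    (Finset.disjoint_empty_right s) ?_
  have h4 : ∏ i, x i ^ q = ∏ z ∈ s, z ^ q := by
    rw [← Finset.prod_coe_sort s fun z => z ^ q]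
    exact s.equivFin.symm.prod_comp fun z : s => (z : S) ^ q
  rw [← h4]
  convert h2 using 1
  rw [hIx, mixedIdeal, Finset.coe_empty, Ideal.span_empty, bot_sup_eq, hq, ← hrange,
    ← Set.range_comp]
  rfl

end Model

/-! ### Thresholds of regular rings -/

section Closure

open MvPolynomial IsLocalRing

theorem thresholds_subset_closure (p : ℕ) [Fact p.Prime] (n : ℕ) (k : Type*) [Field k] [CharP k p]
    [IsAlgClosed k] : thresholds p n ⊆ closure (polyThresholds p n k) := by
  rintro c ⟨R, _, _, _, hreg, hfin, hdim, g, -, hc⟩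
  rw [fpt, sInf_coe_image_eq_iff] at hc
  simp only [testIdeal_span_singleton_ne_top_iff_exists hfin] at hc
  have hp : 1 < (p : ℝ) := by exact_mod_cast (Fact.out : p.Prime).one_lt
  rw [Metric.mem_closure_iff]
  intro ε hε
  obtain ⟨c₁, ⟨hc₁, m, hm, hg₁⟩, hcc₁, hc₁ε⟩ :=
    hc.exists_between (show c < c + ε / 2 by linarith)
  -- The maximal ideal `m` obtained for `c₁` serves for the lower bound too, since below `c` every
  -- maximal ideal fails at some level.
  obtain ⟨e₀, hg₀⟩ : ∃ e₀ : ℕ, g ^ ⌈(c - ε / 2) * (p : ℝ) ^ e₀⌉₊ ∉ frobPower p e₀ m := by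
    by_contra hcon
    push Not at hcon
    -- A nonpositive exponent rounds to `0` in `ℕ`, and level `0` would then put `1` in `m`.
    rcases le_or_gt (c - ε / 2) 0 with h | h
    · have h1 := hcon 0
      rw [pow_zero, mul_one, Nat.ceil_eq_zero.2 h, pow_zero] at h1
      refine hm.ne_top ((Ideal.eq_top_iff_one _).2 ?_)
      simpa [frobPower] using h1
    · have := hc.1 ⟨h, m, hm, hcon⟩
      linarith
  have htend : Filter.Tendsto (fun e : ℕ => 1 / (p : ℝ) ^ e) Filter.atTop (nhds 0) :=
    Filter.Tendsto.div_atTop tendsto_const_nhds (tendsto_pow_atTop_atTop_of_one_lt hp)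
  obtain ⟨e₁, he₁⟩ := (htend.eventually (gt_mem_nhds (half_pos hε))).exists
  have hpe : (0 : ℝ) < (p : ℝ) ^ e₁ := by positivity
  let S := Localization.AtPrime m
  have hchar : CharP S p := charP_of_injective_algebraMap
    (IsLocalization.injective S m.primeCompl_le_nonZeroDivisors) p
  let _ : Algebra (ZMod p) S := ZMod.algebra S p
  have hcharκ : CharP (ResidueField S) p :=
    charP_of_injective_algebraMap (algebraMap (ZMod p) _).injective p
  -- One model must cover both levels: `e₀` bounds the new threshold from below and `e₁` from above.
  obtain ⟨d, f, hd, hf⟩ := exists_polynomial_model (p := p) (algebraMap R S g) (max e₀ e₁)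
  have hdn : d ≤ n := by
    have h1 : ringKrullDim S ≤ ringKrullDim R := by
      rw [IsLocalization.AtPrime.ringKrullDim_eq_height m S]
      exact Ideal.height_le_ringKrullDim_of_ne_top hm.ne_top
    rw [← hd] at h1
    exact_mod_cast h1.trans hdim
  have hmodel : ∀ e ≤ max e₀ e₁, ∀ b : ℕ, f ^ b ∈ monPow d (ResidueField S) (p ^ e) ↔
      g ^ b ∈ frobPower p e m := by
    intro e he b
    rw [hf e he b, ← map_pow, algebraMap_mem_frobPower_maximalIdeal_iff m S]
  rw [← hmodel e₀ (le_max_left _ _)] at hg₀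
  obtain ⟨f', -, hf'₀, hf'⟩ := exists_specialization k f hg₀
  have hf'₁ := hf' _ _ ((hmodel e₁ (le_max_right _ _) _).2 (hg₁ e₁))
  have hf'0 : eval 0 f' = 0 :=
    eval_zero_eq_zero_of_pow_mem (pow_pos (Fact.out : p.Prime).pos e₁) hf'₁
  obtain ⟨c', hc'⟩ := exists_isGLB_polyExpSet (p := p) hf'0
  refine ⟨c', polyThresholds_subset_of_embedding (Fin.castLEEmb hdn)
    (mem_polyThresholds_iff.2 ⟨f', hf'0, hc'⟩), ?_⟩
  have h1 := le_of_pow_ceil_notMem hc' hf'₀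
  have h2 := le_div_of_pow_mem hc' (Nat.ceil_pos.2 (mul_pos hc₁ hpe)) hf'₁
  have h3 : (⌈c₁ * (p : ℝ) ^ e₁⌉₊ : ℝ) / (p : ℝ) ^ e₁ ≤ c₁ + 1 / (p : ℝ) ^ e₁ := by
    rw [div_le_iff₀ hpe, add_mul, one_div, inv_mul_cancel₀ hpe.ne']
    exact (Nat.ceil_lt_add_one (mul_pos hc₁ hpe).le).le
  rw [Real.dist_eq, abs_lt]
  constructor <;> linarith

end Closure

end FPure

end

theorem mainTheorem5 (p : ℕ) [Fact p.Prime] (n : ℕ) (hn : 1 ≤ n) :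
    (∀ (k : Type u) [Field k] [CharP k p],
      FPure.polyThresholds p n k ⊆ FPure.polyThresholds p (n + 1) k) ∧
    (∀ (k : Type u) (K : Type v) [Field k] [CharP k p] [Field K] [Algebra k K],
      FPure.polyThresholds p n k ⊆ FPure.polyThresholds p n K) ∧
    (∀ (k : Type u) (K : Type v) [Field k] [CharP k p] [IsAlgClosed k]
        [Field K] [CharP K p] [IsAlgClosed K],
      FPure.polyThresholds p n k = FPure.polyThresholds p n K) ∧
    (∀ (k : Type u) [Field k] [CharP k p] [IsAlgClosed k],
      FPure.thresholds.{w} p n ⊆ closure (FPure.polyThresholds p n k)) := by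
  refine ⟨fun k _ _ => ?_, fun k K _ _ _ _ => ?_, fun k K _ _ _ _ _ _ => ?_, fun k _ _ _ => ?_⟩
  · exact FPure.polyThresholds_subset_of_embedding Fin.castSuccEmb
  · have : CharP K p := charP_of_injective_algebraMap (algebraMap k K).injective p
    exact FPure.polyThresholds_subset_of_ringHom (algebraMap k K)
  · exact (FPure.polyThresholds_subset_of_isAlgClosed K k).antisymm
      (FPure.polyThresholds_subset_of_isAlgClosed k K)
  · exact FPure.thresholds_subset_closure p n k
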